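/- Let $n\in\mathbb N_0$ and let $(\mu_t)_{t\ge 0}$ be the transition probabilities of a Lévy process $(X_t)_{t\ge 0}$ on $\mathbb R^n$ started at $0$ ($\mu_t$ is the law of $X_t$), i.e. a weakly continuous convolution semigroup of probability measures with $\mu_0=\delta_0$, and let $\psi:\mathbb R^n\to\mathbb C$ be its characteristic exponent, $\int e^{i x\cdot\xi}\,\mu_t(dx)=e^{-t\psi(\xi)}$ for all $t\ge 0$ and $\xi\in\mathbb R^n$. Let $\mathcal L_\psi$ be its generator, i.e. the pseudo-differential operator $\widehat{\mathcal L_\psi u}(\xi)=-\psi(\xi)\widehat u(\xi)$, where $\widehat u(\xi)=(2\pi)^{-n}\int e^{-ix\cdot\xi}u(x)\,dx$. For $f\in L^\infty(\mathbb R^n)$ the distribution $\mathcal L_\psi f$ is defined by $\langle\mathcal L_\psi f,\phi\rangle:=\int f(x)\,\mathcal L_{\overline\psi}\phi(x)\,dx$, $\phi\in C_c^\infty(\mathbb R^n)$. We say that $\mathcal L_\psi$ has the Liouville property if every (complex-valued) $f\in L^\infty(\mathbb R^n)$ with $\langle\mathcal L_\psi f,\phi\rangle=0$ for all $\phi\in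 C_c^\infty(\mathbb R^n)$ is Lebesgue a.e. equal to a constant. 1. Let $g(\zeta)=a\zeta+\int_{(0,\infty)}(1-e^{-\zeta s})\,\pi(ds)$, $\operatorname{Re}\zeta\ge 0$, be a Bernstein function, where $a\ge 0$ and $\pi$ is a measure on $(0,\infty)$ with $\int_{(0,\infty)}\min\{s,1\}\,\pi(ds)<\infty$. Assume that $a\neq 0$ or that $\operatorname{supp}\pi$ (the closed support in $\mathbb R$) is not discrete. Then $g\circ\psi$ is again the characteristic exponent of a Lévy process on $\mathbb R^n$, and $\mathcal L_\psi$ has the Liouville property if, and only if, $\mathcal L_{g\circ\psi}$ has the Liouville property. 2. Let $P_tf(x)=\int f(x+y)\,\mu_t(dy)$ be the transition semigroup, which is generated by $\mathcal L_\psi$, and let $R_\tau f=(\tau\,\mathrm{id}-\mathcal L_\psi)^{-1}f=\int_0^\infty e^{-\tau t}P_tf\,dt$, $\tau>0$, be the resolvent. For $\tau>0$ consider the property $$f\in L^\infty(\mathbb R^n)\ \text{ and }\ \tau R_\tau f=f\ \text{ a.e.}\implies f\ \text{ is a.e. constant.}\qquad(\mathrm R_\tau)$$ Then $\mathcal L_\psi$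 has the Liouville property if, and only if, $(\mathrm R_\tau)$ holds for some $\tau>0$; and also if, and only if, $(\mathrm R_\tau)$ holds for all $\tau>0$. 3. Assume in addition that $\psi=\overline\psi$ is real-valued. For $t>0$ consider the property $$f\in L^\infty(\mathbb R^n)\ \text{ and }\ P_tf=f\ \text{ a.e.}\implies f\ \text{ is a.e. constant.}\qquad(\mathrm P_t)$$ Then $\mathcal L_\psi$ has the Liouville property if, and only if, $(\mathrm P_t)$ holds for some $t>0$; and also if, and only if, $(\mathrm P_t)$ holds for all $t>0$. -/

import Mathlib

open MeasureTheory ProbabilityTheory Filter Topology Set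
open scoped NNReal ENNReal ContDiff FourierTransform ComplexConjugate BoundedContinuousFunction

/-- The Euclidean space of dimension `n`. -/
abbrev Rn (n : ℕ) : Type := EuclideanSpace ℝ (Fin n)

/-- `μ t`, `t ≥ 0`, are the transition probabilities (the laws of `X_t`) of a Lévy process `X` on
`ℝⁿ` started at `0`: a weakly continuous convolution semigroup of probability measures. -/
structure IsLevySemigroup {n : ℕ} (μ : ℝ≥0 → Measure (Rn n)) : Prop where
  prob : ∀ t, IsProbabilityMeasure (μ t)
  zero : μ 0 = Measure.dirac 0
  conv : ∀ s t, μ (s + t) = (μ s).conv (μ t)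
  cont : ∀ u : Rn n →ᵇ ℝ, Tendsto (fun t => ∫ x, u x ∂(μ t)) (𝓝 0) (𝓝 (u 0))

/-- `ψ` is the characteristic exponent (symbol) of the Lévy process with transition probabilities
`μ`, that is, `𝔼 exp (i ξ · X_t) = exp (-t ψ ξ)`. -/
def IsCharacteristicExponent {n : ℕ} (μ : ℝ≥0 → Measure (Rn n)) (ψ : Rn n → ℂ) : Prop :=
  ∀ (t : ℝ≥0) (ξ : Rn n), charFun (μ t) ξ = Complex.exp (-((t : ℝ) : ℂ) * ψ ξ)

/-- The pseudo-differential operator with symbol `-ψ`. In Mathlib's normalisation of the Fourier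
transform (with `exp (-2 π i x · ξ)`) the frequency `ξ` corresponds to `2 π ξ`. -/
noncomputable def levyGenerator {n : ℕ} (ψ : Rn n → ℂ) (u : Rn n → ℂ) : Rn n → ℂ :=
  𝓕⁻ (fun ξ : Rn n => -ψ ((2 * Real.pi) • ξ) * 𝓕 u ξ)

/-- The distribution `φ ↦ ⟨L_ψ f, φ⟩ = ∫ f (L_ψ)^* φ dx` on test functions; the adjoint of `L_ψ`
is the operator whose symbol is the complex conjugate of `ψ`. -/
noncomputable def generatorPairing {n : ℕ} (ψ : Rn n → ℂ) (f φ : Rn n → ℂ) : ℂ :=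
  ∫ x, f x * levyGenerator (fun ξ => conj (ψ ξ)) φ x

/-- `f` agrees Lebesgue almost everywhere with a constant. -/
def IsAEConst {n : ℕ} (f : Rn n → ℂ) : Prop :=
  ∃ c : ℂ, f =ᵐ[volume] fun _ => c

/-- The Liouville property of `L_ψ`: every `f ∈ L^∞` with `L_ψ f = 0` in the sense of
distributions is constant. -/
def LiouvilleProperty {n : ℕ} (ψ : Rn n → ℂ) : Prop :=
  ∀ f : Rn n → ℂ, MemLp f ∞ volume →
    (∀ φ : Rn n → ℂ, ContDiff ℝ ∞ φ → HasCompactSupport φ → generatorPairing ψ f φ = 0) →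
    IsAEConst f

/-- The transition semigroup `P_t f (x) = 𝔼 f (x + X_t)`. -/
noncomputable def transitionOp {n : ℕ} (μ : ℝ≥0 → Measure (Rn n)) (t : ℝ≥0) (f : Rn n → ℂ) :
    Rn n → ℂ :=
  fun x => ∫ y, f (x + y) ∂(μ t)

/-- The resolvent `R_τ f = ∫_0^∞ exp (-τ t) P_t f dt`. -/
noncomputable def resolventOp {n : ℕ} (μ : ℝ≥0 → Measure (Rn n)) (τ : ℝ) (f : Rn n → ℂ) :
    Rn n → ℂ :=
  fun x => ∫ t in Ioi (0 : ℝ), (Real.exp (-τ * t) : ℂ) * transitionOp μ t.toNNReal f x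

/-- Every `f ∈ L^∞` with `τ R_τ f = f` is constant. -/
def ResolventLiouville {n : ℕ} (μ : ℝ≥0 → Measure (Rn n)) (τ : ℝ) : Prop :=
  ∀ f : Rn n → ℂ, MemLp f ∞ volume →
    (fun x => (τ : ℂ) * resolventOp μ τ f x) =ᵐ[volume] f → IsAEConst f

/-- Every `f ∈ L^∞` with `P_t f = f` is constant. -/
def SemigroupLiouville {n : ℕ} (μ : ℝ≥0 → Measure (Rn n)) (t : ℝ≥0) : Prop :=
  ∀ f : Rn n → ℂ, MemLp f ∞ volume → transitionOp μ t f =ᵐ[volume] f → IsAEConst f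

/-- The characteristics of a Bernstein function: a drift `a ≥ 0` and a measure `π` on `(0, ∞)`
which integrates `min s 1`. -/
structure IsBernsteinPair (a : ℝ) (π : Measure ℝ) : Prop where
  drift_nonneg : 0 ≤ a
  concentrated : π (Iic 0) = 0
  integrable_min : ∫⁻ s in Ioi (0 : ℝ), ENNReal.ofReal (min s 1) ∂π < ⊤

/-- The Bernstein function with characteristics `(a, π)` on the closed right half-plane. -/
noncomputable def bernsteinFun (a : ℝ) (π : Measure ℝ) (ζ : ℂ) : ℂ :=
  (a : ℂ) * ζ + ∫ s in Ioi (0 : ℝ), (1 - Complex.exp (-ζ * (s : ℂ))) ∂π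

/-!
# Liouville properties of Lévy generators

All the Liouville properties in question are equivalent to the single condition that `0` is the only
zero of the characteristic exponent `ψ`.

If `ψ η = 0` with `η ≠ 0`, then the character `x ↦ exp (i ⟨x, η⟩)` is a nonconstant bounded solution:
it is annihilated by `L_ψ`, because the Fourier transform of `L_ψ^* φ` vanishes at the corresponding
frequency, and it is left invariant by the averages with respect to `μ_t` and to the resolvent
measure `ρ_τ = ∫₀^∞ τ exp (-τ t) μ_t dt`.

Conversely, let `0` be the only zero of `ψ`. The characteristic function of `ρ_τ` is `τ / (τ + ψ)`
and that of `μ_t` is `exp (-t ψ)`, so that for `ρ_τ`, and for `μ_t` if `ψ` is real, it takes the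
value `1` only at the origin. By the Choquet–Deny theorem (`ae_eq_translate_of_averageOp_eq`) a
bounded continuous function which equals its `ρ`-average is invariant under a closed subgroup of
full `ρ`-measure. A proper closed subgroup of `ℝⁿ` is annihilated by a nontrivial character
(`AddSubgroup.exists_ne_zero_forall_inner_eq_intCast`), at whose frequency the characteristic
function of `ρ` would be `1`; hence the function is constant (`eq_of_averageOp_eq`). Pairing with
test functions extends this to `L^∞` (`isAEConst_of_integral_translatePairing_eq`).

A distributional solution of `L_ψ f = 0` is reduced to the case of `ρ_1`-averages by the resolvent
identity `φ - R_1^* φ = -R_1^* L_ψ^* φ` on test functions `φ`: since `f` is orthogonal to all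
translates of `L_ψ^* φ`, it is orthogonal to `R_1^* L_ψ^* φ`. This needs `L_ψ^* φ ∈ L¹`
(`IsLevySemigroup.integrable_generator`), which is obtained without the Lévy–Khintchine formula:
the bounds `|1 - exp (-t ψ)| ≤ t |ψ|` on the characteristic functions of `μ_t` control the truncated
first and second moments of `μ_t` by multiples of `t`, Taylor's formula then gives
`‖P_t^* φ - φ‖_{L¹} = O(t)`, and Fatou's lemma applies as `t → 0`.

For a Bernstein function `g`, the exponent `g ∘ ψ` belongs to a Lévy process by approximation with
compound Poisson laws and Lévy's continuity theorem (`IsLevySemigroup.exists_subordinate`), and the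
hypothesis on the characteristics forces `g` to vanish only at `0` on the closed right half-plane:
a zero `ζ ≠ 0` would need `a = 0` and would confine `π` to the discrete set where `exp (-ζ s) = 1`
(`IsBernsteinPair.eq_zero_of_bernsteinFun_eq_zero`).
-/

/-! ### Closed subgroups of a Euclidean space -/

section ClosedSubgroup

variable {E : Type*} [NormedAddCommGroup E] [InnerProductSpace ℝ E]

/-- The largest linear subspace contained in an additive subgroup. -/
def AddSubgroup.lineSpace (G : AddSubgroup E) : Submodule ℝ E where
  carrier := {v | ∀ r : ℝ, r • v ∈ G}
  add_mem' := fun ha hb r => by rw [smul_add]; exact G.add_mem (ha r) (hb r)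
  zero_mem' := fun r => by rw [smul_zero]; exact G.zero_mem
  smul_mem' := fun c x hx r => by rw [smul_smul]; exact hx _

theorem AddSubgroup.lineSpace_le (G : AddSubgroup E) {v : E} (hv : v ∈ G.lineSpace) : v ∈ G := by
  simpa using hv 1

variable [FiniteDimensional ℝ E]

/-- Transversally to its lines, a closed subgroup is discrete: the directions of a null sequence of
elements of the subgroup would accumulate at a line contained in it. -/
theorem AddSubgroup.exists_norm_ge_of_isClosed (G : AddSubgroup E) (hG : IsClosed (G : Set E)) :
    ∃ ε > 0, ∀ x ∈ G, x ∈ G.lineSpaceᗮ → ‖x‖ < ε → x = 0 := by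
  by_contra! h
  have h' : ∀ k : ℕ, ∃ x ∈ G, x ∈ G.lineSpaceᗮ ∧ ‖x‖ < 1 / ((k : ℝ) + 1) ∧ x ≠ 0 := fun k =>
    h _ (by positivity)
  choose x hxG hxW hx hx0 using h'
  have hsph : ∀ k, (‖x k‖⁻¹ • x k) ∈ Metric.sphere (0 : E) 1 := fun k => by
    simp [norm_smul, hx0 k]
  obtain ⟨u, hu, φ, hφ, hlim⟩ := (isCompact_sphere (0 : E) 1).tendsto_subseq hsph
  have hx_lim : Tendsto (fun k => ‖x (φ k)‖) atTop (𝓝 0) := by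
    have : Tendsto (fun k => ‖x k‖) atTop (𝓝 0) :=
      squeeze_zero (fun _ => norm_nonneg _) (fun k => (hx k).le)
        tendsto_one_div_add_atTop_nhds_zero_nat
    exact this.comp hφ.tendsto_atTop
  have huV : u ∈ G.lineSpace := by
    intro r
    -- integer multiples of `x (φ k)` approximate `r • u`
    have h1 : Tendsto (fun k => (⌊r / ‖x (φ k)‖⌋ : ℝ) * ‖x (φ k)‖) atTop (𝓝 r) := by
      rw [tendsto_iff_norm_sub_tendsto_zero]
      refine squeeze_zero (fun _ => norm_nonneg _) (fun k => ?_) hx_lim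
      have hpos : 0 < ‖x (φ k)‖ := norm_pos_iff.2 (hx0 _)
      have h1 := Int.floor_le (r / ‖x (φ k)‖)
      have h2 := Int.lt_floor_add_one (r / ‖x (φ k)‖)
      rw [le_div_iff₀ hpos] at h1
      rw [div_lt_iff₀ hpos] at h2
      rw [Real.norm_eq_abs, abs_le]
      constructor <;> nlinarith
    refine hG.mem_of_tendsto (h1.smul hlim) (Eventually.of_forall fun k => ?_)
    have hpos : ‖x (φ k)‖ ≠ 0 := norm_ne_zero_iff.2 (hx0 _)
    have : ((⌊r / ‖x (φ k)‖⌋ : ℝ) * ‖x (φ k)‖) • (‖x (φ k)‖⁻¹ • x (φ k))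
        = ⌊r / ‖x (φ k)‖⌋ • x (φ k) := by
      rw [smul_smul, mul_assoc, mul_inv_cancel₀ hpos, mul_one, Int.cast_smul_eq_zsmul]
    simp only [Function.comp_apply, this]
    exact G.zsmul_mem (hxG _) _
  have huW : u ∈ G.lineSpaceᗮ :=
    (Submodule.isClosed_orthogonal _).mem_of_tendsto hlim
      (Eventually.of_forall fun k => Submodule.smul_mem _ _ (hxW _))
  have : u = 0 := by
    have := Submodule.inner_right_of_mem_orthogonal huV huW
    simpa using this
  simp [this] at hu

/-- A proper closed subgroup of a Euclidean space is annihilated by a nontrivial character. -/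
theorem AddSubgroup.exists_ne_zero_forall_inner_eq_intCast (G : AddSubgroup E)
    (hG : IsClosed (G : Set E)) (hne : (G : Set E) ≠ univ) :
    ∃ ξ : E, ξ ≠ 0 ∧ ∀ y ∈ G, ∃ k : ℤ, inner ℝ ξ y = (k : ℝ) := by
  obtain ⟨ε, hε, hdisc⟩ := G.exists_norm_ge_of_isClosed hG
  set V := G.lineSpace with hV
  -- the part of the subgroup transversal to its lines
  let Λ : Submodule ℤ E := (G ⊓ (Vᗮ).toAddSubgroup).toIntSubmodule
  have hΛ : ∀ x, x ∈ Λ ↔ x ∈ G ∧ x ∈ Vᗮ := fun x => Iff.rfl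
  let U : Submodule ℝ E := Submodule.span ℝ (Λ : Set E)
  have hUV : U ≤ Vᗮ := Submodule.span_le.2 fun x hx => ((hΛ x).1 hx).2
  have hdec : ∀ y ∈ G, y - V.starProjection y ∈ Λ := fun y hy =>
    (hΛ _).2 ⟨G.sub_mem hy (G.lineSpace_le (Submodule.starProjection_apply_mem V y)),
      V.sub_starProjection_mem_orthogonal y⟩
  -- if the transversal part is trivial, any vector orthogonal to the lines annihilates `G`
  by_cases hU : U = ⊥
  · have hVne : Vᗮ ≠ ⊥ := by
      intro h
      rw [Submodule.orthogonal_eq_bot_iff] at h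
      apply hne
      ext y
      simp only [SetLike.mem_coe, mem_univ, iff_true]
      exact G.lineSpace_le (by rw [← hV, h]; trivial)
    obtain ⟨ξ, hξ, hξ0⟩ := Submodule.exists_mem_ne_zero_of_ne_bot hVne
    refine ⟨ξ, hξ0, fun y hy => ⟨0, ?_⟩⟩
    have h1 : y - V.starProjection y = 0 := by
      have : y - V.starProjection y ∈ U := Submodule.subset_span (hdec y hy)
      simpa [hU] using this
    have h2 : y ∈ V := by
      rw [sub_eq_zero.1 h1]; exact Submodule.starProjection_apply_mem V y
    simpa using Submodule.inner_left_of_mem_orthogonal h2 hξ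
  -- otherwise it is a lattice in its span, and a coordinate with respect to a lattice basis is an
  -- integer-valued functional
  let f := U.subtype
  let L₀ : Submodule ℤ U := Λ.comap (f.restrictScalars ℤ)
  have hdiscL : DiscreteTopology L₀ := by
    have : IsOpen ({0} : Set L₀) := by
      rw [Metric.isOpen_singleton_iff]
      refine ⟨ε, hε, fun y hy => ?_⟩
      have hy' := (hΛ _).1 y.2
      refine Subtype.ext (Subtype.ext (hdisc _ hy'.1 hy'.2 ?_))
      simpa [dist_eq_norm] using hy
    exact discreteTopology_of_isOpen_singleton_zero this
  have hlat : IsZLattice ℝ L₀ := ⟨by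
    have h_img : f '' L₀ = Λ := by
      rw [← LinearMap.coe_restrictScalars ℤ f, ← Submodule.map_coe (f.restrictScalars ℤ),
        Submodule.map_comap_eq_self]
      exact fun x hx ↦ LinearMap.mem_range.mpr ⟨⟨x, Submodule.subset_span hx⟩, rfl⟩
    rw [← (Submodule.map_injective_of_injective (Submodule.injective_subtype _)).eq_iff,
      Submodule.map_span, Submodule.map_top, Submodule.range_subtype, h_img]⟩
  have : Module.Free ℤ L₀ := ZLattice.module_free ℝ L₀
  let b := Module.Free.chooseBasis ℤ L₀
  let B := b.ofZLatticeBasis ℝ L₀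
  have : Nontrivial U := Submodule.nontrivial_iff_ne_bot.2 hU
  obtain ⟨i⟩ : Nonempty (Module.Free.ChooseBasisIndex ℤ L₀) := B.index_nonempty
  let ℓ : E →ₗ[ℝ] ℝ := (B.coord i) ∘ₗ (U.orthogonalProjectionOnto : E →ₗ[ℝ] U)
  let ξ : E := (InnerProductSpace.toDual ℝ E).symm (LinearMap.toContinuousLinearMap ℓ)
  have hξ : ∀ y, inner ℝ ξ y = ℓ y := fun y => by
    simp [ξ]
  refine ⟨ξ, fun h0 => ?_, fun y hy => ?_⟩
  · have := hξ (b i : U)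
    rw [h0, inner_zero_left] at this
    have h2 : B (i) = (b i : U) := b.ofZLatticeBasis_apply ℝ L₀ i
    simp [ℓ, ← h2] at this
  · let w : U := ⟨_, Submodule.subset_span (hdec y hy)⟩
    have hw : w ∈ L₀ := hdec y hy
    refine ⟨b.repr ⟨w, hw⟩ i, ?_⟩
    rw [hξ]
    have h1 : U.orthogonalProjectionOnto y = w := by
      have : y = V.starProjection y + (w : E) := by simp [w]
      rw [this, map_add, Submodule.orthogonalProjectionOnto_mem_subspace_eq_self,
        Submodule.orthogonalProjectionOnto_apply_of_mem_orthogonal, zero_add]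
      exact fun u hu => Submodule.inner_left_of_mem_orthogonal
        (Submodule.starProjection_apply_mem V y) (hUV hu)
    have h2 := b.ofZLatticeBasis_repr_apply ℝ L₀ ⟨w, hw⟩ i
    simp only [ℓ, LinearMap.comp_apply]
    simp [h1]
    exact h2

end ClosedSubgroup

/-! ### The Choquet–Deny theorem -/

section ChoquetDeny

variable {E : Type*} [NormedAddCommGroup E] [MeasurableSpace E] [BorelSpace E]

theorem integrable_of_continuous_of_bound {X F : Type*} [TopologicalSpace X] [MeasurableSpace X]
    [OpensMeasurableSpace X] [NormedAddCommGroup F] [SecondCountableTopologyEither X F]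
    {m : Measure X} [IsFiniteMeasure m] {u : X → F} (hu : Continuous u) (C : ℝ)
    (hC : ∀ x, ‖u x‖ ≤ C) : Integrable u m :=
  .of_bound hu.aestronglyMeasurable C (ae_of_all _ hC)

/-- The averaging operator `u ↦ ∫ u (· + y) ρ(dy)` on bounded continuous functions. -/
noncomputable def averageOp (ρ : Measure E) [IsProbabilityMeasure ρ] (u : E →ᵇ ℝ) : E →ᵇ ℝ :=
  BoundedContinuousFunction.ofNormedAddCommGroup (fun x => ∫ y, u (x + y) ∂ρ)
    (continuous_of_dominated (bound := fun _ => ‖u‖)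
      (fun x => (by fun_prop : Continuous fun y => u (x + y)).aestronglyMeasurable)
      (fun x => ae_of_all _ fun y => u.norm_coe_le_norm _) (integrable_const _)
      (ae_of_all _ fun y => by fun_prop))
    ‖u‖ (fun x => by
      simpa using norm_integral_le_of_norm_le_const (μ := ρ)
        (ae_of_all _ fun y => u.norm_coe_le_norm (x + y)))

variable (ρ : Measure E) [IsProbabilityMeasure ρ]

theorem averageOp_apply (u : E →ᵇ ℝ) (x : E) : averageOp ρ u x = ∫ y, u (x + y) ∂ρ := rfl

theorem integrable_translate (u : E →ᵇ ℝ) (x : E) : Integrable (fun y => u (x + y)) ρ :=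
  integrable_of_continuous_of_bound (by fun_prop) ‖u‖ fun y => u.norm_coe_le_norm _

theorem averageOp_mono {u v : E →ᵇ ℝ} (h : ∀ x, u x ≤ v x) (x : E) :
    averageOp ρ u x ≤ averageOp ρ v x :=
  integral_mono (integrable_translate ρ u x) (integrable_translate ρ v x) fun y => h (x + y)

theorem norm_averageOp_le (u : E →ᵇ ℝ) : ‖averageOp ρ u‖ ≤ ‖u‖ :=
  BoundedContinuousFunction.norm_ofNormedAddCommGroup_le _ (norm_nonneg _) _

theorem averageOp_add_smul (u v : E →ᵇ ℝ) (c : ℝ) (x : E) :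
    averageOp ρ (u + c • v) x = averageOp ρ u x + c * averageOp ρ v x := by
  simp only [averageOp_apply, BoundedContinuousFunction.coe_add, Pi.add_apply,
    BoundedContinuousFunction.coe_smul, smul_eq_mul]
  rw [integral_add (integrable_translate ρ u x) ((integrable_translate ρ v x).const_mul c),
    integral_const_mul]

/-- The variance identity. -/
theorem integral_sub_average_sq (u : E →ᵇ ℝ) (x : E) :
    ∫ y, (u (x + y) - averageOp ρ u x) ^ 2 ∂ρ = averageOp ρ (u * u) x - averageOp ρ u x ^ 2 := by
  set m := averageOp ρ u x with hm
  have h1 : ∀ y, (u (x + y) - m) ^ 2 = (u * u) (x + y) - 2 * m * u (x + y) + m ^ 2 := fun y => by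
    simp only [BoundedContinuousFunction.coe_mul, Pi.mul_apply]; ring
  simp_rw [h1]
  have i1 := integrable_translate ρ (u * u) x
  have i2 := (integrable_translate ρ u x).const_mul (2 * m)
  have i3 : Integrable (fun y => (u * u) (x + y) - 2 * m * u (x + y)) ρ := i1.sub i2
  rw [integral_add i3 (integrable_const _), integral_sub i1 i2, integral_const_mul,
    ← averageOp_apply, ← averageOp_apply, ← hm]
  simp only [integral_const, probReal_univ, one_smul]
  ring

theorem averageOp_sq_le (u : E →ᵇ ℝ) (x : E) : averageOp ρ u x ^ 2 ≤ averageOp ρ (u * u) x := by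
  have := integral_sub_average_sq ρ u x
  have h2 : 0 ≤ ∫ y, (u (x + y) - averageOp ρ u x) ^ 2 ∂ρ := integral_nonneg fun y => sq_nonneg _
  linarith

variable [SecondCountableTopology E] in
/-- **Choquet–Deny**: a bounded continuous `ρ`-harmonic function is invariant under translation by
`ρ`-almost every vector. The mean square increment `g = ∫ (F (· + y) - F)² ρ(dy)` equals
`A (F²) - F²` for the averaging operator `A`; since the increments of `F` are harmonic too, their
squares are subharmonic, so `g ≤ A g`. Hence `F² + N g ≤ Aᴺ (F²) ≤ ‖F‖²` for all `N`, and
`g = 0`. -/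
theorem ae_eq_translate_of_averageOp_eq {F : E →ᵇ ℝ} (hF : averageOp ρ F = F) (x : E) :
    ∀ᵐ y ∂ρ, F (x + y) = F x := by
  set g : E →ᵇ ℝ := averageOp ρ (F * F) - F * F with hg
  have hg_eq : ∀ x, g x = ∫ y, (F (x + y) - F x) ^ 2 ∂ρ := fun x => by
    have := integral_sub_average_sq ρ F x
    rw [hF] at this
    rw [this, hg]
    simp [sq]
  have hg_sub : ∀ x, g x ≤ averageOp ρ g x := fun x => by
    have hsw : averageOp ρ g x = ∫ y, ∫ z, (F (x + z + y) - F (x + z)) ^ 2 ∂ρ ∂ρ := by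
      rw [averageOp_apply]
      simp_rw [hg_eq]
      rw [integral_integral_swap]
      refine integrable_of_continuous_of_bound (by fun_prop) ((‖F‖ + ‖F‖) ^ 2) fun p => ?_
      simp only [Function.uncurry, norm_pow]
      gcongr
      exact (norm_sub_le _ _).trans (add_le_add (F.norm_coe_le_norm _) (F.norm_coe_le_norm _))
    rw [hsw, hg_eq]
    have key : ∀ y, (F (x + y) - F x) ^ 2 ≤ ∫ z, (F (x + z + y) - F (x + z)) ^ 2 ∂ρ := fun y => by
      let h : E →ᵇ ℝ := F.compContinuous ⟨fun z => z + y, by fun_prop⟩ - F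
      have h1 : averageOp ρ h x = F (x + y) - F x := by
        have e1 : ∫ z, F (x + z + y) ∂ρ = F (x + y) := by
          conv_rhs => rw [← hF, averageOp_apply]
          congr 1; ext z; congr 1; abel
        have e2 : ∫ z, F (x + z) ∂ρ = F x := by
          conv_rhs => rw [← hF, averageOp_apply]
        rw [averageOp_apply, ← e1, ← e2, ← integral_sub]
        · rfl
        · exact integrable_of_continuous_of_bound (by fun_prop) ‖F‖ fun y => F.norm_coe_le_norm _
        · exact integrable_translate ρ F x
      have h2 := averageOp_sq_le ρ h x
      rw [h1] at h2
      refine h2.trans (le_of_eq ?_)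
      rw [averageOp_apply]
      congr 1; ext z
      simp [h, sq]
    have hcont : Continuous fun y => ∫ z, (F (x + z + y) - F (x + z)) ^ 2 ∂ρ := by
      refine continuous_of_dominated (bound := fun _ => (‖F‖ + ‖F‖) ^ 2)
        (fun y => (by fun_prop : Continuous _).aestronglyMeasurable) (fun y => ae_of_all _ fun z => ?_)
        (integrable_const _) (ae_of_all _ fun z => by fun_prop)
      simp only [norm_pow]
      gcongr
      exact (norm_sub_le _ _).trans (add_le_add (F.norm_coe_le_norm _) (F.norm_coe_le_norm _))
    have hb : ∀ a b, ‖(F a - F b) ^ 2‖ ≤ (‖F‖ + ‖F‖) ^ 2 := fun a b => by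
      simp only [norm_pow]
      gcongr
      exact (norm_sub_le _ _).trans (add_le_add (F.norm_coe_le_norm _) (F.norm_coe_le_norm _))
    refine integral_mono (integrable_of_continuous_of_bound (by fun_prop) _ fun y => hb _ _)
      (integrable_of_continuous_of_bound hcont ((‖F‖ + ‖F‖) ^ 2) fun y => ?_) key
    simpa using norm_integral_le_of_norm_le_const (μ := ρ) (ae_of_all _ fun z => hb (x + z + y) (x + z))
  have hiter : ∀ (N : ℕ) (x : E), (F * F + (N : ℝ) • g) x ≤ ((averageOp ρ)^[N] (F * F)) x := by
    intro N
    induction N with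
    | zero => intro x; simp
    | succ N ih =>
      intro x
      rw [Function.iterate_succ_apply']
      refine le_trans ?_ (averageOp_mono ρ ih x)
      rw [averageOp_add_smul]
      have h1 : averageOp ρ (F * F) x = (F * F) x + g x := by simp [hg]
      have h2 : (N : ℝ) * g x ≤ N * averageOp ρ g x := by gcongr; exact hg_sub x
      simp only [BoundedContinuousFunction.coe_add, Pi.add_apply, BoundedContinuousFunction.coe_smul,
        smul_eq_mul, Nat.cast_succ, h1]
      linarith
  have hbound : ∀ N : ℕ, ‖(averageOp ρ)^[N] (F * F)‖ ≤ ‖F * F‖ := by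
    intro N
    induction N with
    | zero => simp
    | succ N ih =>
      rw [Function.iterate_succ_apply']
      exact (norm_averageOp_le ρ _).trans ih
  have hgx : g x = 0 := by
    refine le_antisymm ?_ (by rw [hg_eq]; exact integral_nonneg fun y => sq_nonneg _)
    by_contra! hpos
    obtain ⟨N, hN⟩ := exists_nat_gt (‖F * F‖ / g x)
    rw [div_lt_iff₀ hpos] at hN
    have h1 := hiter N x
    have h2 := (le_abs_self _).trans ((((averageOp ρ)^[N] (F * F)).norm_coe_le_norm x).trans
      (hbound N))
    have h3 : 0 ≤ (F * F) x := mul_self_nonneg _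
    simp only [BoundedContinuousFunction.coe_add, Pi.add_apply, BoundedContinuousFunction.coe_smul,
      smul_eq_mul] at h1
    linarith
  rw [hg_eq, integral_eq_zero_iff_of_nonneg (fun y => sq_nonneg _)] at hgx
  · filter_upwards [hgx] with y hy
    simpa [sub_eq_zero] using hy
  · refine integrable_of_continuous_of_bound
      (by fun_prop : Continuous fun y => (F (x + y) - F x) ^ 2) ((‖F‖ + ‖F‖) ^ 2) fun y => ?_
    simp only [norm_pow]
    gcongr
    exact (norm_sub_le _ _).trans (add_le_add (F.norm_coe_le_norm _) (F.norm_coe_le_norm _))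

end ChoquetDeny

section ChoquetDenyEuclidean

variable {E : Type*} [NormedAddCommGroup E] [InnerProductSpace ℝ E] [FiniteDimensional ℝ E]
  [MeasurableSpace E] [BorelSpace E]

/-- The subgroup of periods of a function. -/
def periodSubgroup {E X : Type*} [AddCommGroup E] (F : E → X) : AddSubgroup E where
  carrier := {y | ∀ x, F (x + y) = F x}
  add_mem' := fun {a b} ha hb x => by rw [← add_assoc, hb, ha]
  zero_mem' := fun x => by rw [add_zero]
  neg_mem' := fun {a} ha x => by rw [← ha (x + -a), neg_add_cancel_right]

/-- If the only frequency at which the characteristic function of `ρ` equals `1` is `0`, then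
bounded continuous `ρ`-harmonic functions are constant. -/
theorem eq_of_averageOp_eq (ρ : Measure E) [IsProbabilityMeasure ρ]
    (hρ : ∀ ξ, charFun ρ ξ = 1 → ξ = 0) {F : E →ᵇ ℝ} (hF : averageOp ρ F = F) (x y : E) :
    F x = F y := by
  set G := periodSubgroup F
  have hG : IsClosed (G : Set E) := by
    have : (G : Set E) = ⋂ x, {y | F (x + y) = F x} := by ext y; simp [G, periodSubgroup]
    rw [this]
    exact isClosed_iInter fun x => isClosed_eq (by fun_prop) continuous_const
  have hρG : ∀ᵐ y ∂ρ, y ∈ G := by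
    have h1 : ∀ᵐ y ∂ρ, ∀ k : ℕ, F (TopologicalSpace.denseSeq E k + y)
        = F (TopologicalSpace.denseSeq E k) :=
      ae_all_iff.2 fun k => ae_eq_translate_of_averageOp_eq ρ hF _
    filter_upwards [h1] with y hy
    have : (fun x => F (x + y)) = fun x => F x :=
      (TopologicalSpace.denseRange_denseSeq E).equalizer (by fun_prop) (by fun_prop)
        (funext hy)
    exact fun x => congrFun this x
  by_cases hne : (G : Set E) = univ
  · have : y - x ∈ G := by rw [← SetLike.mem_coe, hne]; trivial
    simpa using (this x).symm
  · exfalso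
    obtain ⟨ξ, hξ0, hξ⟩ := G.exists_ne_zero_forall_inner_eq_intCast hG hne
    have h2 : (2 * Real.pi) • ξ ≠ 0 := smul_ne_zero (by positivity) hξ0
    refine h2 (hρ _ ?_)
    rw [charFun_apply]
    have : ∀ᵐ y ∂ρ, Complex.exp (((inner ℝ y ((2 * Real.pi) • ξ) : ℝ) : ℂ) * Complex.I) = 1 := by
      filter_upwards [hρG] with y hy
      obtain ⟨k, hk⟩ := hξ y hy
      rw [inner_smul_right, real_inner_comm, hk, Complex.exp_eq_one_iff]
      exact ⟨k, by push_cast; ring⟩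
    rw [integral_congr_ae this]
    simp

end ChoquetDenyEuclidean

/-! ### Bounded measurable functions which are harmonic in the weak sense -/

section WeakHarmonic

variable {n : ℕ}

/-- The pairing `∫ f (x) φ (x - z) dx` of `f` with the translates of `φ`. -/
noncomputable def translatePairing (f φ : Rn n → ℂ) (z : Rn n) : ℂ := ∫ x, f x * φ (x - z)

theorem MeasureTheory.MemLp.exists_ae_norm_le {f : Rn n → ℂ} (hf : MemLp f ∞ volume) :
    ∃ C : ℝ, 0 ≤ C ∧ ∀ᵐ x, ‖f x‖ ≤ C := by
  refine ⟨(eLpNorm f ∞ volume).toReal, ENNReal.toReal_nonneg, ?_⟩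
  filter_upwards [enorm_ae_le_eLpNormEssSup f volume] with x hx
  rw [← toReal_enorm]
  exact ENNReal.toReal_mono hf.2.ne (by rwa [eLpNorm_exponent_top])

theorem measurePreserving_shear_sub (ρ : Measure (Rn n)) [SFinite ρ] :
    MeasurePreserving (fun p : Rn n × Rn n => (p.1, p.2 - p.1)) (ρ.prod volume)
      (ρ.prod volume) := by
  have := (MeasurePreserving.id ρ).skew_product (g := fun y x : Rn n => x - y) (μc := volume)
    (μd := volume) (by unfold Function.uncurry; fun_prop)
    (ae_of_all _ fun y => by
      simpa using (measurePreserving_sub_right volume y).map_eq)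
  exact this

theorem measurePreserving_shear_add (ρ : Measure (Rn n)) [SFinite ρ] :
    MeasurePreserving (fun p : Rn n × Rn n => (p.1, p.2 + p.1)) (ρ.prod volume)
      (ρ.prod volume) := by
  have := (MeasurePreserving.id ρ).skew_product (g := fun y x : Rn n => x + y) (μc := volume)
    (μd := volume) (by unfold Function.uncurry; fun_prop)
    (ae_of_all _ fun y => by
      simpa using (measurePreserving_add_right volume y).map_eq)
  exact this

theorem integrable_mul_translate (ρ : Measure (Rn n)) [IsFiniteMeasure ρ] {f h : Rn n → ℂ}
    (hf : MemLp f ∞ volume) (hh : Integrable h) :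
    Integrable (fun p : Rn n × Rn n => f p.2 * h (p.2 - p.1)) (ρ.prod volume) := by
  obtain ⟨C, -, hC⟩ := hf.exists_ae_norm_le
  have h1 : Integrable (fun p : Rn n × Rn n => h (p.2 - p.1)) (ρ.prod volume) :=
    (measurePreserving_shear_sub ρ).integrable_comp_of_integrable (hh.comp_snd ρ)
  exact h1.bdd_mul (c := C) hf.1.comp_snd (Measure.quasiMeasurePreserving_snd.ae hC)

theorem translatePairing_translate (f φ : Rn n → ℂ) (z y : Rn n) :
    translatePairing f (fun x => φ (x - z)) y = translatePairing f φ (z + y) := by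
  simp only [translatePairing, sub_sub, add_comm]

theorem norm_translatePairing_le {f φ : Rn n → ℂ} {C : ℝ} (hC : ∀ᵐ x, ‖f x‖ ≤ C)
    (hφ : Integrable φ) (z : Rn n) : ‖translatePairing f φ z‖ ≤ C * ∫ x, ‖φ x‖ := by
  rw [← integral_sub_right_eq_self (fun x => ‖φ x‖) z, ← integral_const_mul]
  refine norm_integral_le_of_norm_le ((hφ.comp_sub_right z).norm.const_mul C) ?_
  filter_upwards [hC] with x hx
  rw [norm_mul]
  gcongr

theorem continuous_translatePairing {f φ : Rn n → ℂ} (hf : MemLp f ∞ volume) (hφ : Continuous φ)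
    (hsupp : HasCompactSupport φ) : Continuous (translatePairing f φ) := by
  have h1 : HasCompactSupport fun u => φ (-u) := hsupp.comp_homeomorph (Homeomorph.neg _)
  have h2 := h1.continuous_convolution_right (ContinuousLinearMap.mul ℝ ℂ) (μ := volume)
    (hf.locallyIntegrable le_top) (by fun_prop)
  have h3 : translatePairing f φ
      = convolution f (fun u => φ (-u)) (ContinuousLinearMap.mul ℝ ℂ) volume := by
    ext z
    simp [translatePairing, convolution]
  rw [h3]
  exact h2

/-- By Fubini, some `x` satisfies `f (x + z) = f x` for almost every `z`. -/
theorem isAEConst_of_translate_eq {f : Rn n → ℂ} (hf : AEStronglyMeasurable f volume)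
    (h : ∀ z, ∀ᵐ x, f (x + z) = f x) : IsAEConst f := by
  set f₀ := hf.mk f
  have hf₀ : Measurable f₀ := hf.stronglyMeasurable_mk.measurable
  have hff : f =ᵐ[volume] f₀ := hf.ae_eq_mk
  have h0 : ∀ z, ∀ᵐ x, f₀ (x + z) = f₀ x := fun z => by
    filter_upwards [h z, hff, (measurePreserving_add_right volume z).quasiMeasurePreserving.ae hff]
      with x h1 h2 h3
    rw [← h2, ← h1, h3]
  have hm : MeasurableSet {p : Rn n × Rn n | f₀ (p.2 + p.1) = f₀ p.2} :=
    measurableSet_eq_fun (by fun_prop) (by fun_prop)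
  have h1 : ∀ᵐ x : Rn n, ∀ᵐ z : Rn n, f₀ (x + z) = f₀ x :=
    (Measure.ae_ae_comm hm).1 (ae_of_all _ h0)
  obtain ⟨x, hx⟩ := h1.exists
  refine ⟨f₀ x, hff.trans ?_⟩
  have h2 := (measurePreserving_add_left volume (-x)).quasiMeasurePreserving.ae hx
  filter_upwards [h2] with z hz
  simpa using hz

theorem eq_of_integral_translate_eq (ρ : Measure (Rn n)) [IsProbabilityMeasure ρ]
    (hρ : ∀ ξ, charFun ρ ξ = 1 → ξ = 0) {F : Rn n → ℝ} (hF : Continuous F) {C : ℝ}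
    (hC : ∀ x, ‖F x‖ ≤ C) (h : ∀ x, ∫ y, F (x + y) ∂ρ = F x) (x y : Rn n) : F x = F y :=
  eq_of_averageOp_eq ρ hρ (F := .ofNormedAddCommGroup F hF C hC)
    (BoundedContinuousFunction.ext h) x y

/-- The Choquet–Deny theorem for `f ∈ L^∞`, harmonicity being tested against smooth compactly
supported functions. -/
theorem isAEConst_of_integral_translatePairing_eq (ρ : Measure (Rn n)) [IsProbabilityMeasure ρ]
    (hρ : ∀ ξ, charFun ρ ξ = 1 → ξ = 0) {f : Rn n → ℂ} (hf : MemLp f ∞ volume)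
    (h : ∀ φ : Rn n → ℂ, ContDiff ℝ ∞ φ → HasCompactSupport φ →
      ∫ y, translatePairing f φ y ∂ρ = translatePairing f φ 0) : IsAEConst f := by
  obtain ⟨C, hC0, hC⟩ := hf.exists_ae_norm_le
  have hconst : ∀ φ : Rn n → ℂ, ContDiff ℝ ∞ φ → HasCompactSupport φ → ∀ z,
      translatePairing f φ z = translatePairing f φ 0 := by
    intro φ hφ hsupp z
    have hcont := continuous_translatePairing hf hφ.continuous hsupp
    have hbd := norm_translatePairing_le hC (hφ.continuous.integrable_of_hasCompactSupport hsupp)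
    have hharm : ∀ x, ∫ y, translatePairing f φ (x + y) ∂ρ = translatePairing f φ x := fun x => by
      have := h (fun u => φ (u - x)) (by fun_prop) (hsupp.comp_homeomorph (Homeomorph.subRight x))
      simpa only [translatePairing_translate, add_zero] using this
    have hint : ∀ x, Integrable (fun y => translatePairing f φ (x + y)) ρ := fun x =>
      integrable_of_continuous_of_bound (by fun_prop) _ fun y => hbd _
    -- the Choquet–Deny theorem applies to the real and imaginary parts
    have hpart : ∀ L : ℂ →L[ℝ] ℝ, ‖L‖ ≤ 1 →
        L (translatePairing f φ z) = L (translatePairing f φ 0) := fun L hL =>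
      eq_of_integral_translate_eq ρ hρ (L.continuous.comp hcont)
        (fun x => (L.le_of_opNorm_le hL _).trans (by rw [one_mul]; exact hbd x))
        (fun x => by
          simp only [Function.comp_apply]
          rw [L.integral_comp_comm (hint x), hharm]) z 0
    exact Complex.ext (hpart Complex.reCLM Complex.reCLM_norm.le)
      (hpart Complex.imCLM Complex.imCLM_norm.le)
  refine isAEConst_of_translate_eq hf.1 fun z => ?_
  have hfz : LocallyIntegrable (fun x => f (x + z)) volume :=
    (hf.comp_measurePreserving (measurePreserving_add_right volume z)).locallyIntegrable le_top
  have hg1 : ∀ g : Rn n → ℝ, ContDiff ℝ ∞ g → HasCompactSupport g →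
      ∫ x, g x • f (x + z) = ∫ x, g x • f x := fun g hg hgs => by
    have hgc : HasCompactSupport fun x => (g x : ℂ) := hgs.comp_left (g := Complex.ofReal) rfl
    have h1 := hconst (fun x => (g x : ℂ)) (Complex.ofRealCLM.contDiff.comp hg) hgc z
    simp only [translatePairing, sub_zero] at h1
    rw [← integral_add_right_eq_self _ z] at h1
    simpa only [add_sub_cancel_right, Complex.real_smul, mul_comm] using h1
  exact ae_eq_of_integral_contDiff_smul_eq hfz (hf.locallyIntegrable le_top) hg1

/-- A function in `L^∞` which agrees almost everywhere with its `ρ`-average is `ρ`-harmonic in the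
weak sense. -/
theorem integral_translatePairing_eq_of_ae_eq (ρ : Measure (Rn n)) [IsProbabilityMeasure ρ]
    {f : Rn n → ℂ} (hf : MemLp f ∞ volume) (h : (fun x => ∫ y, f (x + y) ∂ρ) =ᵐ[volume] f)
    {φ : Rn n → ℂ} (hφ : Integrable φ) :
    ∫ y, translatePairing f φ y ∂ρ = translatePairing f φ 0 := by
  have hint := (measurePreserving_shear_add ρ).integrable_comp_of_integrable
    (integrable_mul_translate ρ hf hφ)
  have h1 : ∀ y, translatePairing f φ y = ∫ x, f (x + y) * φ x := fun y => by
    rw [translatePairing, ← integral_add_right_eq_self _ y]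
    simp
  simp_rw [h1]
  rw [integral_integral_swap (by simpa [Function.comp_def, Function.uncurry_def] using hint)]
  simp only [integral_mul_const, add_zero]
  refine integral_congr_ae ?_
  filter_upwards [h] with x hx
  rw [hx]

/-- Characters are not constant. -/
theorem not_isAEConst_character {η : Rn n} (hη : η ≠ 0) :
    ¬ IsAEConst fun x : Rn n => Complex.exp (((inner ℝ x η : ℝ) : ℂ) * Complex.I) := by
  rintro ⟨c, hc⟩
  have h1 := (Continuous.ae_eq_iff_eq volume (by fun_prop) (by fun_prop)).1 hc
  have h2 := (congrFun h1 0).trans (congrFun h1 ((Real.pi / ‖η‖ ^ 2) • η)).symm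
  have h3 : ‖η‖ ^ 2 ≠ 0 := by simpa using hη
  simp only [inner_zero_left, Complex.ofReal_zero, zero_mul, Complex.exp_zero,
    real_inner_smul_left, real_inner_self_eq_norm_sq, div_mul_cancel₀ _ h3, Complex.exp_pi_mul_I]
    at h2
  norm_num at h2

theorem memLp_character (η : Rn n) :
    MemLp (fun x : Rn n => Complex.exp (((inner ℝ x η : ℝ) : ℂ) * Complex.I)) ∞ volume :=
  memLp_top_of_bound (by fun_prop : Continuous _).aestronglyMeasurable 1
    (ae_of_all _ fun x => (Complex.norm_exp_ofReal_mul_I _).le)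

theorem integral_character_add (ρ : Measure (Rn n)) (η x : Rn n) :
    ∫ y, Complex.exp (((inner ℝ (x + y) η : ℝ) : ℂ) * Complex.I) ∂ρ
      = charFun ρ η * Complex.exp (((inner ℝ x η : ℝ) : ℂ) * Complex.I) := by
  rw [charFun_apply, ← integral_mul_const]
  congr 1; ext y
  rw [← Complex.exp_add, inner_add_left]
  congr 1
  push_cast; ring

end WeakHarmonic

/-! ### Mixtures and limits of probability measures -/

section Mixtures

variable {n : ℕ}

theorem integral_bind_eq {α β F : Type*} [MeasurableSpace α] [MeasurableSpace β]
    [NormedAddCommGroup F] [NormedSpace ℝ F] {m : Measure α} {κ : α → Measure β}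
    (hκ : Measurable κ) {u : β → F} (hu : Integrable u (m.bind κ)) :
    ∫ z, u z ∂(m.bind κ) = ∫ a, ∫ z, u z ∂(κ a) ∂m := by
  have h1 : ((⟨κ, hκ⟩ : Kernel α β) ∘ₖ Kernel.const Unit m) () = m.bind κ := by
    rw [Kernel.comp_apply, Kernel.const_apply]; rfl
  have := Kernel.integral_comp (κ := Kernel.const Unit m) (η := ⟨κ, hκ⟩) (a := ()) (f := u)
    (by rwa [h1])
  rwa [h1, Kernel.const_apply] at this

theorem charFun_bind {α : Type*} [MeasurableSpace α] {m : Measure α} [IsProbabilityMeasure m]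
    {κ : α → Measure (Rn n)} (hκ : Measurable κ) (hκp : ∀ a, IsProbabilityMeasure (κ a))
    (ξ : Rn n) : charFun (m.bind κ) ξ = ∫ a, charFun (κ a) ξ ∂m := by
  have := isProbabilityMeasure_bind (m := m) hκ.aemeasurable (ae_of_all _ hκp)
  simp only [charFun_apply]
  refine integral_bind_eq hκ ?_
  exact integrable_of_continuous_of_bound (by fun_prop) 1
    fun x => (Complex.norm_exp_ofReal_mul_I _).le

/-- A family of probability measures whose characteristic functions depend continuously on the
parameter is weakly continuous. -/
theorem continuous_probabilityMeasure_of_charFun {X : Type*} [TopologicalSpace X]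
    [SequentialSpace X] {κ : X → ProbabilityMeasure (Rn n)}
    (h : ∀ ξ, Continuous fun t => charFun (κ t : Measure (Rn n)) ξ) : Continuous κ := by
  refine continuous_iff_seqContinuous.2 fun x t hx => ?_
  exact ProbabilityMeasure.tendsto_of_tendsto_charFun fun ξ => ((h ξ).tendsto t).comp hx

theorem measurable_of_continuous_probabilityMeasure {X : Type*} [TopologicalSpace X]
    [MeasurableSpace X] [OpensMeasurableSpace X] {κ : X → ProbabilityMeasure (Rn n)}
    (h : Continuous κ) : Measurable fun t => (κ t : Measure (Rn n)) := by
  refine Measurable.measure_of_isPiSystem_of_isProbabilityMeasure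
    (S := {s | IsClosed s}) (by rw [← borel_eq_generateFrom_isClosed]; exact BorelSpace.measurable_eq)
    isPiSystem_isClosed fun s hs => ?_
  refine measurable_of_tendsto_metrizable (f := fun k t => ∫⁻ x, IsClosed.apprSeq hs k x ∂(κ t))
    (fun k => ?_) ?_
  · refine Continuous.measurable (continuous_iff_continuousAt.2 fun t => ?_)
    exact (ProbabilityMeasure.tendsto_iff_forall_lintegral_tendsto.1 (h.tendsto t)) _
  · rw [tendsto_pi_nhds]
    exact fun t => HasOuterApproxClosed.tendsto_lintegral_apprSeq hs _

/-- Lévy's continuity theorem: a pointwise limit of characteristic functions which is continuous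
at `0` is a characteristic function. -/
theorem exists_charFun_eq_of_tendsto {ν : ℕ → Measure (Rn n)} (hν : ∀ k, IsProbabilityMeasure (ν k))
    {f : Rn n → ℂ} (hf : ContinuousAt f 0)
    (h : ∀ ξ, Tendsto (fun k => charFun (ν k) ξ) atTop (𝓝 (f ξ))) :
    ∃ ρ : Measure (Rn n), IsProbabilityMeasure ρ ∧ charFun ρ = f := by
  have htight := isTightMeasureSet_of_tendsto_charFun hf h
  let N : ℕ → ProbabilityMeasure (Rn n) := fun k => ⟨ν k, hν k⟩
  have hcomp : IsCompact (closure (range N)) := by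
    refine isCompact_closure_of_isTightMeasureSet ?_
    have hrange : {x : Measure (Rn n) | ∃ ν ∈ range N, (ν : Measure (Rn n)) = x} = range ν := by
      ext m
      constructor
      · rintro ⟨_, ⟨k, rfl⟩, rfl⟩; exact ⟨k, rfl⟩
      · rintro ⟨k, rfl⟩; exact ⟨_, ⟨k, rfl⟩, rfl⟩
    rwa [hrange]
  obtain ⟨ρ, -, hρ⟩ := hcomp.ultrafilter_le_nhds' ((hyperfilter ℕ).map N)
    (Filter.mem_of_superset (Filter.range_mem_map) subset_closure)
  refine ⟨ρ, inferInstance, ?_⟩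
  ext ξ
  have h1 : Tendsto N (hyperfilter ℕ : Filter ℕ) (𝓝 ρ) := hρ
  have h2 := (ProbabilityMeasure.tendsto_iff_forall_integral_rclike_tendsto ℂ).1 h1
    (BoundedContinuousFunction.innerProbChar ξ)
  have h3 : Tendsto (fun k => charFun (ν k) ξ) (hyperfilter ℕ) (𝓝 (charFun (ρ : Measure (Rn n)) ξ)) := by
    simp only [charFun_eq_integral_innerProbChar]
    exact h2
  exact tendsto_nhds_unique h3 ((h ξ).mono_left Nat.hyperfilter_le_atTop)

end Mixtures

/-! ### The characteristic exponent -/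

section Exponent

variable {n : ℕ} {μ : ℝ≥0 → Measure (Rn n)} {ψ : Rn n → ℂ}

theorem IsCharacteristicExponent.charFun_toNNReal (hψ : IsCharacteristicExponent μ ψ) {t : ℝ}
    (ht : 0 ≤ t) (ξ : Rn n) : charFun (μ t.toNNReal) ξ = Complex.exp (-(t : ℂ) * ψ ξ) := by
  rw [hψ, Real.coe_toNNReal t ht]

theorem IsLevySemigroup.re_exponent_nonneg (hμ : IsLevySemigroup μ)
    (hψ : IsCharacteristicExponent μ ψ) (ξ : Rn n) : 0 ≤ (ψ ξ).re := by
  have := hμ.prob 1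
  have h1 := norm_charFun_le_one (μ := μ 1) ξ
  rw [hψ, Complex.norm_exp] at h1
  simpa using h1

theorem IsLevySemigroup.measurable (hμ : IsLevySemigroup μ) (hψ : IsCharacteristicExponent μ ψ) :
    Measurable μ := by
  let κ : ℝ≥0 → ProbabilityMeasure (Rn n) := fun t => ⟨μ t, hμ.prob t⟩
  have h1 : Continuous κ := by
    refine continuous_probabilityMeasure_of_charFun fun ξ => ?_
    simp only [κ, ProbabilityMeasure.coe_mk, hψ _ ξ]
    fun_prop
  exact measurable_of_continuous_probabilityMeasure h1

theorem integral_exp_neg_mul_exp {τ : ℝ} (hτ : 0 < τ) {z : ℂ} (hz : 0 ≤ z.re) :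
    ∫ t in Ioi (0 : ℝ), (Real.exp (-τ * t) : ℂ) * Complex.exp (-(t : ℂ) * z) = 1 / (τ + z) := by
  have h1 : ∀ t : ℝ, (Real.exp (-τ * t) : ℂ) * Complex.exp (-(t : ℂ) * z)
      = Complex.exp (-(τ + z) * t) := fun t => by
    rw [Complex.ofReal_exp, ← Complex.exp_add]; push_cast; congr 1; ring
  simp_rw [h1]
  rw [integral_exp_mul_complex_Ioi (by simp; linarith)]
  simp only [Complex.ofReal_zero, mul_zero, Complex.exp_zero, neg_div_neg_eq]

/-- The exponential law with parameter `τ`. -/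
noncomputable def expLaw (τ : ℝ) : Measure ℝ :=
  (volume.restrict (Ioi 0)).withDensity fun t => ENNReal.ofReal (τ * Real.exp (-τ * t))

theorem integral_expLaw {τ : ℝ} (hτ : 0 < τ) (u : ℝ → ℂ) :
    ∫ t, u t ∂(expLaw τ) = τ * ∫ t in Ioi (0 : ℝ), (Real.exp (-τ * t) : ℂ) * u t := by
  rw [expLaw, integral_withDensity_eq_integral_toReal_smul (by fun_prop)
    (ae_of_all _ fun t => ENNReal.ofReal_lt_top), ← integral_const_mul]
  congr 1; ext t
  rw [ENNReal.toReal_ofReal (by positivity), Complex.real_smul]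
  push_cast; ring

theorem isProbabilityMeasure_expLaw {τ : ℝ} (hτ : 0 < τ) : IsProbabilityMeasure (expLaw τ) := by
  refine ⟨?_⟩
  have h1 : IntegrableOn (fun t => τ * Real.exp (-τ * t)) (Ioi 0) :=
    (integrableOn_exp_mul_Ioi (by linarith) 0).const_mul τ
  rw [expLaw, withDensity_apply _ MeasurableSet.univ, Measure.restrict_univ,
    ← ofReal_integral_eq_lintegral_ofReal h1 (ae_of_all _ fun t => by positivity),
    integral_const_mul, integral_exp_mul_Ioi (by linarith)]
  field_simp
  simp

/-- The measure `∫₀^∞ τ exp (-τ t) μ_t dt` which represents `τ R_τ`. -/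
noncomputable def resolventMeasure (μ : ℝ≥0 → Measure (Rn n)) (τ : ℝ) : Measure (Rn n) :=
  (expLaw τ).bind fun t => μ t.toNNReal

theorem IsLevySemigroup.isProbabilityMeasure_resolventMeasure (hμ : IsLevySemigroup μ)
    (hψ : IsCharacteristicExponent μ ψ) {τ : ℝ} (hτ : 0 < τ) :
    IsProbabilityMeasure (resolventMeasure μ τ) := by
  have := isProbabilityMeasure_expLaw hτ
  exact isProbabilityMeasure_bind ((hμ.measurable hψ).comp measurable_real_toNNReal).aemeasurable
    (ae_of_all _ fun t => hμ.prob _)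

theorem IsLevySemigroup.charFun_resolventMeasure (hμ : IsLevySemigroup μ)
    (hψ : IsCharacteristicExponent μ ψ) {τ : ℝ} (hτ : 0 < τ) (ξ : Rn n) :
    charFun (resolventMeasure μ τ) ξ = τ / (τ + ψ ξ) := by
  have := isProbabilityMeasure_expLaw hτ
  rw [resolventMeasure, charFun_bind (κ := fun t : ℝ => μ t.toNNReal)
    ((hμ.measurable hψ).comp measurable_real_toNNReal)
    (fun t => hμ.prob _), integral_expLaw hτ]
  have h1 : ∫ t in Ioi (0 : ℝ), (Real.exp (-τ * t) : ℂ) * charFun (μ t.toNNReal) ξ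
      = ∫ t in Ioi (0 : ℝ), (Real.exp (-τ * t) : ℂ) * Complex.exp (-(t : ℂ) * ψ ξ) :=
    setIntegral_congr_fun measurableSet_Ioi fun t ht => by
      simp only [hψ.charFun_toNNReal (le_of_lt ht)]
  rw [h1, integral_exp_neg_mul_exp hτ (hμ.re_exponent_nonneg hψ ξ), mul_one_div]

theorem IsLevySemigroup.add_exponent_ne_zero (hμ : IsLevySemigroup μ)
    (hψ : IsCharacteristicExponent μ ψ) {τ : ℝ} (hτ : 0 < τ) (ξ : Rn n) : (τ : ℂ) + ψ ξ ≠ 0 := by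
  intro h
  have h1 := congrArg Complex.re h
  have := hμ.re_exponent_nonneg hψ ξ
  simp at h1
  linarith

/-- The exponent is continuous because `1 / (1 + ψ)` is the characteristic function of a
probability measure. -/
theorem IsLevySemigroup.continuous_exponent (hμ : IsLevySemigroup μ)
    (hψ : IsCharacteristicExponent μ ψ) : Continuous ψ := by
  have := hμ.isProbabilityMeasure_resolventMeasure hψ one_pos
  have h0 := hμ.add_exponent_ne_zero hψ one_pos
  have h1 : ψ = fun ξ => 1 / charFun (resolventMeasure μ 1) ξ - 1 := by
    ext ξ
    rw [hμ.charFun_resolventMeasure hψ one_pos]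
    have := h0 ξ
    field_simp
    simp
  rw [h1]
  refine (continuous_const.div (by fun_prop) fun ξ => ?_).sub continuous_const
  rw [hμ.charFun_resolventMeasure hψ one_pos]
  exact div_ne_zero (by simp) (h0 ξ)

theorem IsLevySemigroup.charFun_resolventMeasure_eq_one_iff (hμ : IsLevySemigroup μ)
    (hψ : IsCharacteristicExponent μ ψ) {τ : ℝ} (hτ : 0 < τ) (ξ : Rn n) :
    charFun (resolventMeasure μ τ) ξ = 1 ↔ ψ ξ = 0 := by
  rw [hμ.charFun_resolventMeasure hψ hτ, div_eq_one_iff_eq (hμ.add_exponent_ne_zero hψ hτ ξ)]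
  simp

theorem IsLevySemigroup.exponent_zero (hμ : IsLevySemigroup μ)
    (hψ : IsCharacteristicExponent μ ψ) : ψ 0 = 0 := by
  have := hμ.isProbabilityMeasure_resolventMeasure hψ one_pos
  exact (hμ.charFun_resolventMeasure_eq_one_iff hψ one_pos 0).1 (by simp)

theorem norm_one_sub_exp_neg_le {z : ℂ} (hz : 0 ≤ z.re) : ‖1 - Complex.exp (-z)‖ ≤ ‖z‖ := by
  have h1 : ∀ s ∈ Icc (0 : ℝ) 1, HasDerivWithinAt (fun s : ℝ => Complex.exp (-(s * z)))
      (-z * Complex.exp (-(s * z))) (Icc 0 1) s := fun s _ => by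
    have := (((hasDerivAt_id (s : ℂ)).mul_const z).neg.cexp).comp_ofReal.hasDerivWithinAt
      (s := Icc (0 : ℝ) 1)
    simpa [mul_comm] using this
  have h2 := norm_image_sub_le_of_norm_deriv_le_segment_01' (C := ‖z‖) h1 fun s hs => by
    rw [norm_mul, norm_neg, Complex.norm_exp]
    refine mul_le_of_le_one_right (norm_nonneg _) (Real.exp_le_one_iff.2 ?_)
    simpa using mul_nonneg hs.1 hz
  rw [norm_sub_rev]
  simpa using h2

theorem IsLevySemigroup.norm_one_sub_charFun_le (hμ : IsLevySemigroup μ)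
    (hψ : IsCharacteristicExponent μ ψ) (t : ℝ≥0) (ξ : Rn n) :
    ‖1 - charFun (μ t) ξ‖ ≤ t * ‖ψ ξ‖ := by
  rw [hψ, neg_mul]
  refine (norm_one_sub_exp_neg_le ?_).trans (by simp)
  simpa using mul_nonneg t.2 (hμ.re_exponent_nonneg hψ ξ)

end Exponent

/-! ### Truncated moments of the transition probabilities and growth of the exponent -/

section Moments

variable {n : ℕ} {μ : ℝ≥0 → Measure (Rn n)} {ψ : Rn n → ℂ}

/-- The truncated square is controlled by `1 - cos` for `|s| ≤ 1`, because `2 / π² ≥ 1 / 5`. -/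
theorem min_one_sq_le (s : ℝ) :
    min 1 (s ^ 2) ≤ 5 * (1 - Real.cos s) + {s : ℝ | 1 < |s|}.indicator 1 s := by
  have hcos := Real.cos_le_one s
  by_cases hs : 1 < |s|
  · rw [indicator_of_mem (by exact hs)]
    have := min_le_left 1 (s ^ 2)
    simp only [Pi.one_apply]
    linarith
  · rw [indicator_of_notMem (by exact hs), add_zero]
    push Not at hs
    have hpi := Real.pi_gt_three
    have hpi4 := Real.pi_lt_d2
    have h1 := Real.cos_le_one_sub_mul_cos_sq (x := s) (by linarith)
    have h2 : 1 / 5 * s ^ 2 ≤ 2 / Real.pi ^ 2 * s ^ 2 := by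
      refine mul_le_mul_of_nonneg_right ?_ (sq_nonneg s)
      rw [div_le_div_iff₀ (by norm_num) (by positivity)]
      nlinarith
    have := min_le_right 1 (s ^ 2)
    linarith

/-- The part `|⟨a, y⟩| ≤ 1` is bounded by the real part of `1 - charFun (μ t) a`, the tail by an
integral of `1 - charFun (μ t)` over a segment in the direction `a`. -/
theorem IsLevySemigroup.exists_integral_min_inner_le (hμ : IsLevySemigroup μ)
    (hψ : IsCharacteristicExponent μ ψ) (a : Rn n) :
    ∃ K : ℝ, 0 ≤ K ∧ ∀ t, ∫ y, min 1 ((inner ℝ a y) ^ 2) ∂(μ t) ≤ K * t := by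
  obtain ⟨M, hM⟩ := (isCompact_Icc (a := (-2 : ℝ)) (b := 2)).exists_bound_of_continuousOn
    (f := fun s => ψ (s • a))
    ((hμ.continuous_exponent hψ).comp (by fun_prop : Continuous fun s : ℝ => s • a)).continuousOn
  refine ⟨5 * ‖ψ a‖ + 2 * M, ?_, fun t => ?_⟩
  · have := (norm_nonneg _).trans (hM 0 (by norm_num))
    positivity
  have := hμ.prob t
  have hms : MeasurableSet {y : Rn n | 1 < |(inner ℝ a y : ℝ)|} :=
    measurableSet_lt measurable_const (by fun_prop)
  have i1 : Integrable (fun y : Rn n => 5 * (1 - Real.cos (inner ℝ a y))) (μ t) := by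
    refine integrable_of_continuous_of_bound (by fun_prop) 10 fun y => ?_
    have h1 := Real.cos_le_one (inner ℝ a y)
    have h2 := Real.neg_one_le_cos (inner ℝ a y)
    rw [Real.norm_eq_abs, abs_le]
    constructor <;> linarith
  have i2 : Integrable ({y : Rn n | 1 < |(inner ℝ a y : ℝ)|}.indicator (1 : Rn n → ℝ)) (μ t) :=
    (integrable_const 1).indicator hms
  have h1 : ∫ y, min 1 ((inner ℝ a y) ^ 2) ∂(μ t) ≤ ∫ y, (5 * (1 - Real.cos (inner ℝ a y))
      + {y : Rn n | 1 < |(inner ℝ a y : ℝ)|}.indicator 1 y) ∂(μ t) := by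
    refine integral_mono ?_ (i1.add i2) fun y => ?_
    · refine integrable_of_continuous_of_bound (by fun_prop) 1 fun y => ?_
      rw [Real.norm_of_nonneg (by positivity)]
      exact min_le_left _ _
    · exact min_one_sq_le (inner ℝ a y)
  rw [integral_add i1 i2, integral_const_mul, integral_indicator_one hms] at h1
  have h2 : ∫ y, (1 - Real.cos (inner ℝ a y)) ∂(μ t) ≤ t * ‖ψ a‖ := by
    refine le_trans (le_of_eq ?_) ((Complex.re_le_norm _).trans (hμ.norm_one_sub_charFun_le hψ t a))
    have i3 : Integrable (fun y : Rn n => Complex.exp (((inner ℝ y a : ℝ) : ℂ) * Complex.I)) (μ t) :=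
      integrable_of_continuous_of_bound (by fun_prop) 1 fun y =>
        (Complex.norm_exp_ofReal_mul_I _).le
    have h4 : (charFun (μ t) a).re = ∫ y, Real.cos (inner ℝ a y) ∂(μ t) := by
      rw [charFun_apply, ← RCLike.re_eq_complex_re, ← integral_re i3]
      congr 1; ext y
      rw [RCLike.re_eq_complex_re, Complex.exp_ofReal_mul_I_re, real_inner_comm]
    rw [Complex.sub_re, h4, integral_sub (integrable_const _)]
    · simp
    · exact integrable_of_continuous_of_bound (by fun_prop) 1 fun y => Real.abs_cos_le_one _
  have h3 : (μ t).real {y : Rn n | 1 < |(inner ℝ a y : ℝ)|} ≤ 2 * M * t := by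
    refine (measureReal_abs_inner_gt_le_integral_charFun one_pos).trans ?_
    have := intervalIntegral.norm_integral_le_of_norm_le_const (C := t * M) (a := -2 * (1 : ℝ)⁻¹)
      (b := 2 * (1 : ℝ)⁻¹) (f := fun s => 1 - charFun (μ t) (s • a)) fun s hs => by
        refine (hμ.norm_one_sub_charFun_le hψ t _).trans ?_
        gcongr
        refine hM s ?_
        rw [uIoc_of_le (by norm_num)] at hs
        norm_num at hs
        exact ⟨hs.1.le, hs.2⟩
    norm_num at this ⊢
    linarith
  linarith

theorem continuous_min_one_norm_sq : Continuous fun y : Rn n => min 1 (‖y‖ ^ 2) := by fun_prop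

theorem norm_min_one_norm_sq_le (y : Rn n) : ‖min 1 (‖y‖ ^ 2)‖ ≤ 1 := by
  rw [Real.norm_of_nonneg (by positivity)]
  exact min_le_left _ _

theorem integrable_min_one_norm_sq (ρ : Measure (Rn n)) [IsFiniteMeasure ρ] :
    Integrable (fun y : Rn n => min 1 (‖y‖ ^ 2)) ρ :=
  integrable_of_continuous_of_bound continuous_min_one_norm_sq 1 norm_min_one_norm_sq_le

/-- `∫ min (1, |y|²) μ_t(dy) = O(t)`. -/
theorem IsLevySemigroup.exists_integral_min_norm_sq_le (hμ : IsLevySemigroup μ)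
    (hψ : IsCharacteristicExponent μ ψ) :
    ∃ K : ℝ, 0 ≤ K ∧ ∀ t, ∫ y, min 1 (‖y‖ ^ 2) ∂(μ t) ≤ K * t := by
  choose K hK0 hK using fun j : Fin n =>
    hμ.exists_integral_min_inner_le hψ (EuclideanSpace.single j (1 : ℝ))
  refine ⟨∑ j, K j, Finset.sum_nonneg fun j _ => hK0 j, fun t => ?_⟩
  have := hμ.prob t
  rw [Finset.sum_mul]
  refine le_trans ?_ (Finset.sum_le_sum fun j _ => hK j t)
  have hint : ∀ j ∈ (Finset.univ : Finset (Fin n)), Integrable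
      (fun y : Rn n => min 1 ((inner ℝ (EuclideanSpace.single j (1 : ℝ)) y) ^ 2)) (μ t) :=
    fun j _ => by
      refine integrable_of_continuous_of_bound (by fun_prop) 1 fun y => ?_
      rw [Real.norm_of_nonneg (by positivity)]
      exact min_le_left _ _
  rw [← integral_finsetSum _ hint]
  refine integral_mono (integrable_min_one_norm_sq _) (integrable_finsetSum _ hint) fun y => ?_
  have hnn : ∀ j ∈ (Finset.univ : Finset (Fin n)),
      0 ≤ min 1 ((inner ℝ (EuclideanSpace.single j (1 : ℝ)) y) ^ 2) := fun j _ => by positivity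
  -- either all coordinates are at most `1`, or a single one of them accounts for the minimum
  by_cases h : ∀ j, (inner ℝ (EuclideanSpace.single j (1 : ℝ)) y) ^ 2 ≤ 1
  · have h1 : ‖y‖ ^ 2 = ∑ j, min 1 ((inner ℝ (EuclideanSpace.single j (1 : ℝ)) y) ^ 2) := by
      rw [EuclideanSpace.norm_sq_eq]
      refine Finset.sum_congr rfl fun j _ => ?_
      rw [min_eq_right (h j)]
      simp [EuclideanSpace.inner_single_left]
    exact (min_le_right _ _).trans h1.le
  · push Not at h
    obtain ⟨j, hj⟩ := h
    refine (min_le_left _ _).trans (le_trans ?_ (Finset.single_le_sum hnn (Finset.mem_univ j)))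
    rw [min_eq_left hj.le]

/-- The truncated drift `∫_{|y| ≤ 1} y μ_t(dy)`. -/
noncomputable def truncatedMean (ρ : Measure (Rn n)) : Rn n :=
  ∫ y, (Metric.closedBall (0 : Rn n) 1).indicator (fun y => y) y ∂ρ

theorem norm_truncation_le (y : Rn n) :
    ‖(Metric.closedBall (0 : Rn n) 1).indicator (fun y => y) y‖ ≤ 1 := by
  by_cases h : y ∈ Metric.closedBall (0 : Rn n) 1
  · rw [indicator_of_mem h]; simpa using h
  · rw [indicator_of_notMem h]; simp

theorem integrable_truncation (ρ : Measure (Rn n)) [IsFiniteMeasure ρ] :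
    Integrable ((Metric.closedBall (0 : Rn n) 1).indicator fun y => y) ρ :=
  .of_bound ((measurable_id.indicator measurableSet_closedBall).aestronglyMeasurable) 1
    (ae_of_all _ norm_truncation_le)

theorem inner_truncatedMean (ρ : Measure (Rn n)) [IsFiniteMeasure ρ] (a : Rn n) :
    inner ℝ a (truncatedMean ρ)
      = ∫ y, inner ℝ a ((Metric.closedBall (0 : Rn n) 1).indicator (fun y => y) y) ∂ρ :=
  (integral_inner (integrable_truncation ρ) a).symm

/-- `∫_{|y| ≤ 1} y μ_t(dy) = O(t)`; the mean is compared with `∫ sin ⟨y, e⟩ μ_t(dy)`, the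
imaginary part of the characteristic function. -/
theorem IsLevySemigroup.exists_norm_truncatedMean_le (hμ : IsLevySemigroup μ)
    (hψ : IsCharacteristicExponent μ ψ) :
    ∃ K : ℝ, 0 ≤ K ∧ ∀ t, ‖truncatedMean (μ t)‖ ≤ K * t := by
  obtain ⟨K, hK0, hK⟩ := hμ.exists_integral_min_norm_sq_le hψ
  let e : Fin n → Rn n := fun j => EuclideanSpace.single j (1 : ℝ)
  refine ⟨∑ j : Fin n, (K + ‖ψ (e j)‖), Finset.sum_nonneg fun j _ => by positivity, fun t => ?_⟩
  have := hμ.prob t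
  have hcoord : ∀ j, |inner ℝ (e j) (truncatedMean (μ t))| ≤ (K + ‖ψ (e j)‖) * t := by
    intro j
    have i1 : Integrable (fun y : Rn n => inner ℝ (e j)
        ((Metric.closedBall (0 : Rn n) 1).indicator (fun y => y) y)) (μ t) :=
      (integrable_truncation (μ t)).const_inner (𝕜 := ℝ) (e j)
    have i2 : Integrable (fun y : Rn n => Real.sin (inner ℝ (e j) y)) (μ t) :=
      integrable_of_continuous_of_bound (by fun_prop) 1 fun y => Real.abs_sin_le_one _
    have h1 : |∫ y, Real.sin (inner ℝ (e j) y) ∂(μ t)| ≤ t * ‖ψ (e j)‖ := by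
      have i3 : Integrable (fun y : Rn n =>
          Complex.exp (((inner ℝ y (e j) : ℝ) : ℂ) * Complex.I)) (μ t) :=
        integrable_of_continuous_of_bound (by fun_prop) 1 fun y =>
          (Complex.norm_exp_ofReal_mul_I _).le
      have h4 : (charFun (μ t) (e j)).im = ∫ y, Real.sin (inner ℝ (e j) y) ∂(μ t) := by
        rw [charFun_apply, ← RCLike.im_eq_complex_im, ← integral_im i3]
        congr 1; ext y
        rw [RCLike.im_eq_complex_im, Complex.exp_ofReal_mul_I_im, real_inner_comm]
      have h5 := (Complex.abs_im_le_norm _).trans (hμ.norm_one_sub_charFun_le hψ t (e j))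
      rwa [Complex.sub_im, Complex.one_im, zero_sub, abs_neg, h4] at h5
    have h2 : |inner ℝ (e j) (truncatedMean (μ t)) - ∫ y, Real.sin (inner ℝ (e j) y) ∂(μ t)|
        ≤ K * t := by
      rw [inner_truncatedMean, ← integral_sub i1 i2, ← Real.norm_eq_abs]
      refine (norm_integral_le_of_norm_le (integrable_min_one_norm_sq (μ t))
        (ae_of_all _ fun y => ?_)).trans (hK t)
      have hs : |inner ℝ (e j) y| ≤ ‖y‖ := by
        refine (abs_real_inner_le_norm _ _).trans ?_
        simp [e]
      by_cases hy : y ∈ Metric.closedBall (0 : Rn n) 1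
      · rw [indicator_of_mem hy]
        have hy1 : ‖y‖ ≤ 1 := by simpa using hy
        have h6 : ‖y‖ ^ 2 ≤ 1 := by nlinarith [norm_nonneg y]
        rw [min_eq_right h6]
        refine (Real.abs_sub_sin_le _).trans ?_
        have h7 : |inner ℝ (e j) y| ^ 3 ≤ ‖y‖ ^ 3 := by gcongr
        have h8 : ‖y‖ ^ 3 ≤ ‖y‖ ^ 2 := pow_le_pow_of_le_one (norm_nonneg _) hy1 (by norm_num)
        nlinarith [norm_nonneg y, sq_nonneg ‖y‖]
      · rw [indicator_of_notMem hy]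
        have hy1 : 1 < ‖y‖ := by simpa using hy
        rw [min_eq_left (by nlinarith)]
        simpa using Real.abs_sin_le_one _
    rw [abs_le] at h1 h2 ⊢
    constructor <;> linarith [h1.1, h1.2, h2.1, h2.2]
  have hsum : truncatedMean (μ t) = ∑ j, inner ℝ (e j) (truncatedMean (μ t)) • e j := by
    have := (EuclideanSpace.basisFun (Fin n) ℝ).sum_repr' (truncatedMean (μ t))
    simpa [e] using this.symm
  rw [hsum, Finset.sum_mul]
  refine (norm_sum_le _ _).trans (Finset.sum_le_sum fun j _ => ?_)
  rw [norm_smul]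
  simpa [e] using hcoord j

theorem norm_exp_sub_one_sub_truncation_le (ξ y : Rn n) :
    ‖Complex.exp (((inner ℝ y ξ : ℝ) : ℂ) * Complex.I) - 1 - ((inner ℝ ξ
      ((Metric.closedBall (0 : Rn n) 1).indicator (fun y => y) y) : ℝ) : ℂ) * Complex.I‖
      ≤ 3 * (1 + ‖ξ‖ ^ 2) * min 1 (‖y‖ ^ 2) := by
  have h2 : ∀ s : ℝ, ‖Complex.exp ((s : ℂ) * Complex.I) - 1‖ ≤ 2 := fun s => by
    refine (norm_sub_le _ _).trans ?_
    rw [Complex.norm_exp_ofReal_mul_I]; norm_num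
  by_cases hy : y ∈ Metric.closedBall (0 : Rn n) 1
  · rw [indicator_of_mem hy]
    have hy1 : ‖y‖ ≤ 1 := by simpa using hy
    rw [min_eq_right (by nlinarith [norm_nonneg y]), real_inner_comm]
    set s : ℝ := inner ℝ ξ y
    have hs : |s| ≤ ‖ξ‖ * ‖y‖ := abs_real_inner_le_norm _ _
    have hs2 : s ^ 2 ≤ ‖ξ‖ ^ 2 * ‖y‖ ^ 2 := by
      rw [← sq_abs, ← mul_pow]; gcongr
    have hgoal : 3 * s ^ 2 ≤ 3 * (1 + ‖ξ‖ ^ 2) * ‖y‖ ^ 2 := by nlinarith [sq_nonneg ‖y‖]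
    have hns : ‖(s : ℂ) * Complex.I‖ = |s| := by simp
    refine le_trans ?_ hgoal
    by_cases h1 : |s| ≤ 1
    · have := Complex.norm_exp_sub_one_sub_id_le (x := (s : ℂ) * Complex.I) (by rwa [hns])
      rw [hns, sq_abs] at this
      nlinarith [sq_nonneg s]
    · push Not at h1
      refine (norm_sub_le _ _).trans ?_
      rw [hns, ← sq_abs]
      nlinarith [h2 s]
  · rw [indicator_of_notMem hy]
    have hy1 : 1 < ‖y‖ := by simpa using hy
    rw [min_eq_left (by nlinarith)]
    simp only [inner_zero_right, Complex.ofReal_zero, zero_mul, sub_zero]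
    nlinarith [sq_nonneg ‖ξ‖, h2 (inner ℝ y ξ)]

/-- The difference quotients of `t ↦ exp (-t z)` at `0` along `t = 1 / (k + 1)`. -/
theorem tendsto_exp_neg_sub_one_div (z : ℂ) :
    Tendsto (fun k : ℕ => ((k : ℂ) + 1) * (Complex.exp (-((1 / ((k : ℝ) + 1) : ℝ) : ℂ) * z) - 1))
      atTop (𝓝 (-z)) := by
  have h1 : HasDerivAt (fun w : ℂ => Complex.exp (-w * z)) (-z) 0 := by
    have := ((hasDerivAt_id (0 : ℂ)).neg.mul_const z).cexp
    simpa using this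
  have h2 := h1.tendsto_slope_zero
  have h3 : Tendsto (fun k : ℕ => ((1 / ((k : ℝ) + 1) : ℝ) : ℂ)) atTop (𝓝[≠] 0) := by
    refine tendsto_nhdsWithin_iff.2 ⟨?_, Eventually.of_forall fun k => ?_⟩
    · have := (Complex.continuous_ofReal.tendsto 0).comp
        (tendsto_one_div_add_atTop_nhds_zero_nat (𝕜 := ℝ))
      simpa [Function.comp_def] using this
    · simp only [mem_compl_iff, mem_singleton_iff, Complex.ofReal_eq_zero]
      positivity
  refine (h2.comp h3).congr fun k => ?_
  simp

/-- The exponent of a Lévy process grows at most quadratically. -/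
theorem IsLevySemigroup.exists_norm_exponent_le (hμ : IsLevySemigroup μ)
    (hψ : IsCharacteristicExponent μ ψ) :
    ∃ C : ℝ, 0 ≤ C ∧ ∀ ξ, ‖ψ ξ‖ ≤ C * (1 + ‖ξ‖ ^ 2) := by
  obtain ⟨K, hK0, hK⟩ := hμ.exists_integral_min_norm_sq_le hψ
  obtain ⟨B, hB0, hB⟩ := hμ.exists_norm_truncatedMean_le hψ
  refine ⟨3 * K + B, by positivity, fun ξ => ?_⟩
  have hbound : ∀ t : ℝ≥0, ‖charFun (μ t) ξ - 1‖ ≤ t * ((3 * K + B) * (1 + ‖ξ‖ ^ 2)) := by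
    intro t
    have := hμ.prob t
    have i1 : Integrable (fun y : Rn n => Complex.exp (((inner ℝ y ξ : ℝ) : ℂ) * Complex.I)) (μ t) :=
      integrable_of_continuous_of_bound (by fun_prop) 1 fun y =>
        (Complex.norm_exp_ofReal_mul_I _).le
    have i2 : Integrable (fun y : Rn n => ((inner ℝ ξ
        ((Metric.closedBall (0 : Rn n) 1).indicator (fun y => y) y) : ℝ) : ℂ) * Complex.I) (μ t) :=
      ((integrable_truncation (μ t)).const_inner (𝕜 := ℝ) ξ).ofReal.mul_const _
    have h1 := norm_integral_le_of_norm_le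
      ((integrable_min_one_norm_sq (μ t)).const_mul (3 * (1 + ‖ξ‖ ^ 2)))
      (ae_of_all _ (norm_exp_sub_one_sub_truncation_le ξ))
    have i3 : Integrable (fun y : Rn n =>
        Complex.exp (((inner ℝ y ξ : ℝ) : ℂ) * Complex.I) - 1) (μ t) := i1.sub (integrable_const 1)
    rw [integral_sub i3 i2, integral_sub i1 (integrable_const 1),
      ← charFun_apply, integral_mul_const, integral_complex_ofReal, ← inner_truncatedMean,
      integral_const_mul] at h1
    simp only [integral_const, probReal_univ, one_smul] at h1
    have h2 : ‖((inner ℝ ξ (truncatedMean (μ t)) : ℝ) : ℂ) * Complex.I‖ ≤ ‖ξ‖ * (B * t) := by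
      simp only [norm_mul, Complex.norm_I, mul_one, Complex.norm_real, Real.norm_eq_abs]
      refine (abs_real_inner_le_norm _ _).trans ?_
      gcongr
      exact hB t
    have h3 : 3 * (1 + ‖ξ‖ ^ 2) * ∫ y, min 1 (‖y‖ ^ 2) ∂(μ t) ≤ 3 * (1 + ‖ξ‖ ^ 2) * (K * t) := by
      gcongr
      exact hK t
    have h4 := norm_le_norm_sub_add (charFun (μ t) ξ - 1)
      (((inner ℝ ξ (truncatedMean (μ t)) : ℝ) : ℂ) * Complex.I)
    have h5 : ‖ξ‖ * (B * t) ≤ (1 + ‖ξ‖ ^ 2) * (B * t) := by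
      have : 0 ≤ B * (t : ℝ) := by positivity
      gcongr
      nlinarith [sq_nonneg (‖ξ‖ - 1)]
    calc _ ≤ _ := h4
      _ ≤ 3 * (1 + ‖ξ‖ ^ 2) * (K * t) + (1 + ‖ξ‖ ^ 2) * (B * t) := by linarith
      _ = _ := by ring
  -- divide by `t` and let `t → 0` along `t = 1 / (k + 1)`
  have hlim := (tendsto_exp_neg_sub_one_div (ψ ξ)).norm
  rw [norm_neg] at hlim
  refine le_of_tendsto hlim (Eventually.of_forall fun k => ?_)
  have h1 := hbound (1 / ((k : ℝ≥0) + 1))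
  rw [hψ] at h1
  push_cast at h1
  have hk : ‖(k : ℂ) + 1‖ = (k : ℝ) + 1 := by
    rw [show (k : ℂ) + 1 = (((k : ℝ) + 1 : ℝ) : ℂ) by push_cast; rfl, Complex.norm_real,
      Real.norm_of_nonneg (by positivity)]
  rw [norm_mul, hk]
  push_cast
  refine (mul_le_mul_of_nonneg_left h1 (by positivity)).trans (le_of_eq ?_)
  field_simp

end Moments

/-! ### The generator on test functions -/

section Generator

variable {n : ℕ} {μ : ℝ≥0 → Measure (Rn n)} {ψ : Rn n → ℂ}

/-- Second order Taylor estimate, integrated in the base point. For `|y| > 1` the linear term is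
truncated and the increment is only bounded by `2 ‖φ‖_{L¹}`. -/
theorem exists_lintegral_taylor_le {φ : Rn n → ℂ} (hφ : ContDiff ℝ ∞ φ)
    (hsupp : HasCompactSupport φ) :
    ∃ K : ℝ≥0∞, K ≠ ⊤ ∧ ∀ y, ∫⁻ x, ‖φ (x - y) - φ x + fderiv ℝ φ x
      ((Metric.closedBall (0 : Rn n) 1).indicator (fun y => y) y)‖ₑ
        ≤ K * ENNReal.ofReal (min 1 (‖y‖ ^ 2)) := by
  have hcont := hφ.continuous
  have hint : Integrable φ := hcont.integrable_of_hasCompactSupport hsupp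
  obtain ⟨M, hM⟩ := (hφ.fderiv_right (m := 1) (by norm_cast)).lipschitzWith_of_hasCompactSupport
    (hsupp.fderiv ℝ) one_ne_zero
  obtain ⟨R, hR⟩ := hsupp.isCompact.isBounded.subset_closedBall (0 : Rn n)
  refine ⟨ENNReal.ofReal M * volume (Metric.closedBall (0 : Rn n) (R + 1)) + 2 * ∫⁻ x, ‖φ x‖ₑ, ?_,
    fun y => ?_⟩
  · have h1 : volume (Metric.closedBall (0 : Rn n) (R + 1)) ≠ ⊤ := measure_closedBall_lt_top.ne
    have h2 : ∫⁻ x, ‖φ x‖ₑ ≠ ⊤ := hint.2.ne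
    finiteness
  by_cases hy : y ∈ Metric.closedBall (0 : Rn n) 1
  · have hy1 : ‖y‖ ≤ 1 := by simpa using hy
    rw [indicator_of_mem hy, min_eq_right (by nlinarith [norm_nonneg y])]
    have hpt : ∀ x, ‖φ (x - y) - φ x + fderiv ℝ φ x y‖ₑ ≤
        (Metric.closedBall (0 : Rn n) (R + 1)).indicator
          (fun _ => ENNReal.ofReal (M * ‖y‖ ^ 2)) x := by
      intro x
      by_cases hx : x ∈ Metric.closedBall (0 : Rn n) (R + 1)
      · rw [indicator_of_mem hx, ← ofReal_norm]
        refine ENNReal.ofReal_le_ofReal ?_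
        have h1 := (convex_closedBall x ‖y‖).norm_image_sub_le_of_norm_hasFDerivWithin_le'
          (f := φ) (f' := fderiv ℝ φ) (φ := fderiv ℝ φ x) (C := M * ‖y‖) (x := x) (y := x - y)
          (fun z _ => (hφ.differentiable (by simp) z).hasFDerivAt.hasFDerivWithinAt)
          (fun z hz => by
            have := hM.dist_le_mul z x
            rw [dist_eq_norm] at this
            refine this.trans ?_
            gcongr
            simpa using hz)
          (by simp) (by simp)
        rw [sub_sub_cancel_left, map_neg, sub_neg_eq_add, norm_neg] at h1
        calc _ ≤ _ := h1
          _ = _ := by ring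
      · rw [indicator_of_notMem hx]
        have hx1 : R + 1 < ‖x‖ := by simpa using hx
        have h1 : x ∉ tsupport φ := fun h => by
          have := hR h
          simp at this
          linarith
        have h2 : x - y ∉ tsupport φ := fun h => by
          have := hR h
          simp only [Metric.mem_closedBall, dist_zero_right] at this
          have h3 := norm_sub_norm_le x y
          linarith
        rw [image_eq_zero_of_notMem_tsupport h1, image_eq_zero_of_notMem_tsupport h2,
          fderiv_of_notMem_tsupport ℝ h1]
        simp
    refine (lintegral_mono hpt).trans ?_
    rw [lintegral_indicator_const measurableSet_closedBall,
      ENNReal.ofReal_mul (by positivity)]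
    calc _ = ENNReal.ofReal M * volume (Metric.closedBall (0 : Rn n) (R + 1))
          * ENNReal.ofReal (‖y‖ ^ 2) := by ring
      _ ≤ _ := by gcongr; exact le_self_add
  · have hy1 : 1 < ‖y‖ := by simpa using hy
    rw [indicator_of_notMem hy, min_eq_left (by nlinarith), ENNReal.ofReal_one, mul_one]
    simp only [map_zero, add_zero]
    calc ∫⁻ x, ‖φ (x - y) - φ x‖ₑ ≤ ∫⁻ x, (‖φ (x - y)‖ₑ + ‖φ x‖ₑ) :=
          lintegral_mono fun x => enorm_sub_le
      _ = 2 * ∫⁻ x, ‖φ x‖ₑ := by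
          rw [lintegral_add_right _ hcont.enorm.measurable,
            lintegral_sub_right_eq_self (fun x => ‖φ x‖ₑ) y, two_mul]
      _ ≤ _ := le_add_self

/-- `‖P_t^* φ - φ‖_{L¹} = O(t)` for test functions `φ`. -/
theorem IsLevySemigroup.exists_lintegral_sub_le (hμ : IsLevySemigroup μ)
    (hψ : IsCharacteristicExponent μ ψ) {φ : Rn n → ℂ} (hφ : ContDiff ℝ ∞ φ)
    (hsupp : HasCompactSupport φ) :
    ∃ K : ℝ≥0∞, K ≠ ⊤ ∧ ∀ t : ℝ≥0, ∫⁻ x, ‖∫ y, φ (x - y) ∂(μ t) - φ x‖ₑ ≤ K * t := by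
  obtain ⟨A, hA0, hA⟩ := hμ.exists_integral_min_norm_sq_le hψ
  obtain ⟨B, hB0, hB⟩ := hμ.exists_norm_truncatedMean_le hψ
  obtain ⟨K, hKtop, hK⟩ := exists_lintegral_taylor_le hφ hsupp
  have hcont := hφ.continuous
  have hDcont : Continuous (fderiv ℝ φ) := hφ.continuous_fderiv (by simp)
  have hDint : Integrable (fderiv ℝ φ) :=
    hDcont.integrable_of_hasCompactSupport (hsupp.fderiv ℝ)
  obtain ⟨M, hM⟩ := hsupp.exists_bound_of_continuous hcont
  refine ⟨K * ENNReal.ofReal A + (∫⁻ x, ‖fderiv ℝ φ x‖ₑ) * ENNReal.ofReal B, ?_, fun t => ?_⟩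
  · have h2 : ∫⁻ x, ‖fderiv ℝ φ x‖ₑ ≠ ⊤ := hDint.2.ne
    finiteness
  have := hμ.prob t
  set τ : Rn n → Rn n := (Metric.closedBall (0 : Rn n) 1).indicator (fun y => y) with hτ
  have hτm : Measurable τ := measurable_id.indicator measurableSet_closedBall
  -- the linear term is added and subtracted under the integral
  have hsplit : ∀ x, ∫ y, φ (x - y) ∂(μ t) - φ x
      = ∫ y, (φ (x - y) - φ x + fderiv ℝ φ x (τ y)) ∂(μ t) - fderiv ℝ φ x (truncatedMean (μ t)) := by
    intro x
    have i1 : Integrable (fun y => φ (x - y)) (μ t) :=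
      integrable_of_continuous_of_bound (by fun_prop) M fun y => hM _
    have i2 : Integrable (fun y => φ (x - y) - φ x) (μ t) := i1.sub (integrable_const _)
    have i3 : Integrable (fun y => fderiv ℝ φ x (τ y)) (μ t) :=
      (fderiv ℝ φ x).integrable_comp (integrable_truncation (μ t))
    rw [integral_add i2 i3, integral_sub i1 (integrable_const _),
      (fderiv ℝ φ x).integral_comp_comm (integrable_truncation (μ t))]
    simp [truncatedMean]
  have hmeas : Measurable (Function.uncurry fun x y : Rn n =>
      ‖φ (x - y) - φ x + fderiv ℝ φ x (τ y)‖ₑ) := by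
    have h1 : Measurable fun p : Rn n × Rn n => fderiv ℝ φ p.1 (τ p.2) := by
      have h2 : Continuous fun q : (Rn n →L[ℝ] ℂ) × Rn n => q.1 q.2 := by fun_prop
      exact h2.measurable.comp
        ((hDcont.measurable.comp measurable_fst).prodMk (hτm.comp measurable_snd))
    have h3 : Measurable fun p : Rn n × Rn n => φ (p.1 - p.2) - φ p.1 :=
      (by fun_prop : Continuous _).measurable
    exact (h3.add h1).enorm
  calc ∫⁻ x, ‖∫ y, φ (x - y) ∂(μ t) - φ x‖ₑ
      ≤ ∫⁻ x, ((∫⁻ y, ‖φ (x - y) - φ x + fderiv ℝ φ x (τ y)‖ₑ ∂(μ t))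
          + ‖fderiv ℝ φ x‖ₑ * ‖truncatedMean (μ t)‖ₑ) := by
        refine lintegral_mono fun x => ?_
        rw [hsplit]
        exact enorm_sub_le.trans
          (add_le_add (enorm_integral_le_lintegral_enorm _) (ContinuousLinearMap.le_opENorm _ _))
    _ = (∫⁻ y, (∫⁻ x, ‖φ (x - y) - φ x + fderiv ℝ φ x (τ y)‖ₑ) ∂(μ t))
          + (∫⁻ x, ‖fderiv ℝ φ x‖ₑ) * ‖truncatedMean (μ t)‖ₑ := by
        rw [lintegral_add_right _ (by fun_prop), lintegral_mul_const _ (by fun_prop),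
          lintegral_lintegral_swap hmeas.aemeasurable]
    _ ≤ K * ENNReal.ofReal (A * t) + (∫⁻ x, ‖fderiv ℝ φ x‖ₑ) * ENNReal.ofReal (B * t) := by
        gcongr
        · refine (lintegral_mono hK).trans ?_
          rw [lintegral_const_mul' _ _ hKtop,
            ← ofReal_integral_eq_lintegral_ofReal (integrable_min_one_norm_sq (μ t))
              (ae_of_all _ fun y => by positivity)]
          gcongr
          exact hA t
        · rw [← ofReal_norm]
          exact ENNReal.ofReal_le_ofReal (hB t)
    _ = _ := by
        rw [ENNReal.ofReal_mul hA0, ENNReal.ofReal_mul hB0, ENNReal.ofReal_coe_nnreal]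
        ring

/-- Averaging an inverse Fourier transform multiplies the symbol by the conjugate of the
characteristic function. -/
theorem integral_fourierInv_sub (ρ : Measure (Rn n)) [IsProbabilityMeasure ρ] {h : Rn n → ℂ}
    (hh : Integrable h) (x : Rn n) :
    ∫ y, 𝓕⁻ h (x - y) ∂ρ = 𝓕⁻ (fun ξ => conj (charFun ρ ((2 * Real.pi) • ξ)) * h ξ) x := by
  simp only [Real.fourierInv_eq', smul_eq_mul]
  rw [integral_integral_swap]
  · congr 1; ext ξ
    rw [integral_mul_const, ← charFun_neg, charFun_apply, ← mul_assoc, ← integral_const_mul]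
    congr 2; ext y
    rw [← Complex.exp_add]
    congr 1
    simp only [inner_sub_right, inner_neg_right, inner_smul_right, real_inner_comm]
    push_cast
    ring
  · have h1 : Integrable (fun p : Rn n × Rn n => h p.2) (ρ.prod volume) := hh.comp_snd ρ
    refine h1.bdd_mul (c := 1) ?_ (ae_of_all _ fun p => ?_)
    · exact (by fun_prop : Continuous fun p : Rn n × Rn n => Complex.exp
        (↑(2 * Real.pi * inner ℝ p.2 (x - p.1)) * Complex.I)).aestronglyMeasurable
    · exact (Complex.norm_exp_ofReal_mul_I _).le

theorem fourierInv_fourier_of_hasCompactSupport {φ : Rn n → ℂ} (hφ : ContDiff ℝ ∞ φ)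
    (hsupp : HasCompactSupport φ) : 𝓕⁻ (𝓕 φ) = φ := by
  let s : SchwartzMap (Rn n) ℂ := hsupp.toSchwartzMap hφ
  have h1 : 𝓕 φ = (𝓕 s : SchwartzMap (Rn n) ℂ) := SchwartzMap.fourier_coe s
  refine hφ.continuous.fourierInv_fourier_eq (hφ.continuous.integrable_of_hasCompactSupport hsupp) ?_
  rw [h1]
  exact SchwartzMap.integrable _

theorem continuous_fourier_of_hasCompactSupport {φ : Rn n → ℂ} (hφ : ContDiff ℝ ∞ φ)
    (hsupp : HasCompactSupport φ) : Continuous (𝓕 φ) := by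
  let s : SchwartzMap (Rn n) ℂ := hsupp.toSchwartzMap hφ
  have h1 : 𝓕 φ = (𝓕 s : SchwartzMap (Rn n) ℂ) := SchwartzMap.fourier_coe s
  rw [h1]
  exact SchwartzMap.continuous _

theorem integrable_fourier_of_hasCompactSupport {φ : Rn n → ℂ} (hφ : ContDiff ℝ ∞ φ)
    (hsupp : HasCompactSupport φ) : Integrable (𝓕 φ) := by
  let s : SchwartzMap (Rn n) ℂ := hsupp.toSchwartzMap hφ
  have h1 : 𝓕 φ = (𝓕 s : SchwartzMap (Rn n) ℂ) := SchwartzMap.fourier_coe s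
  rw [h1]
  exact SchwartzMap.integrable _

theorem IsLevySemigroup.integrable_symbol_mul_fourier (hμ : IsLevySemigroup μ)
    (hψ : IsCharacteristicExponent μ ψ) {φ : Rn n → ℂ} (hφ : ContDiff ℝ ∞ φ)
    (hsupp : HasCompactSupport φ) :
    Integrable fun ξ => -conj (ψ ((2 * Real.pi) • ξ)) * 𝓕 φ ξ := by
  obtain ⟨C, hC0, hC⟩ := hμ.exists_norm_exponent_le hψ
  have hψc := hμ.continuous_exponent hψ
  have hFc := continuous_fourier_of_hasCompactSupport hφ hsupp
  let s : SchwartzMap (Rn n) ℂ := hsupp.toSchwartzMap hφ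
  have h1 : 𝓕 φ = (𝓕 s : SchwartzMap (Rn n) ℂ) := SchwartzMap.fourier_coe s
  have h2 := ((integrable_fourier_of_hasCompactSupport hφ hsupp).norm.add
    ((SchwartzMap.integrable_pow_mul volume (𝓕 s) 2).const_mul ((2 * Real.pi) ^ 2))).const_mul C
  refine h2.mono' (by fun_prop : Continuous _).aestronglyMeasurable (ae_of_all _ fun ξ => ?_)
  rw [norm_mul, norm_neg, RCLike.norm_conj]
  refine (mul_le_mul_of_nonneg_right (hC _) (norm_nonneg _)).trans (le_of_eq ?_)
  simp only [Pi.add_apply, ← h1, norm_smul, Real.norm_of_nonneg Real.two_pi_pos.le]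
  ring

/-- The difference quotients of the adjoint semigroup converge pointwise to the generator. -/
theorem IsLevySemigroup.tendsto_generator (hμ : IsLevySemigroup μ)
    (hψ : IsCharacteristicExponent μ ψ) {φ : Rn n → ℂ} (hφ : ContDiff ℝ ∞ φ)
    (hsupp : HasCompactSupport φ) (x : Rn n) :
    Tendsto (fun k : ℕ => ((k : ℂ) + 1) * (∫ y, φ (x - y) ∂(μ (1 / ((k : ℝ≥0) + 1))) - φ x)) atTop
      (𝓝 (levyGenerator (fun ξ => conj (ψ ξ)) φ x)) := by
  have hinv := fourierInv_fourier_of_hasCompactSupport hφ hsupp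
  have hFint := integrable_fourier_of_hasCompactSupport hφ hsupp
  have hFc := continuous_fourier_of_hasCompactSupport hφ hsupp
  have hψc := hμ.continuous_exponent hψ
  have hk : ∀ k : ℕ, ((k : ℂ) + 1) * (∫ y, φ (x - y) ∂(μ (1 / ((k : ℝ≥0) + 1))) - φ x)
      = ∫ ξ, Complex.exp (↑(2 * Real.pi * inner ℝ ξ x) * Complex.I) *
        (((k : ℂ) + 1) * (conj (charFun (μ (1 / ((k : ℝ≥0) + 1))) ((2 * Real.pi) • ξ)) - 1)
          * 𝓕 φ ξ) := by
    intro k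
    have := hμ.prob (1 / ((k : ℝ≥0) + 1))
    have h1 := integral_fourierInv_sub (μ (1 / ((k : ℝ≥0) + 1))) hFint x
    rw [hinv] at h1
    have h2 : φ x = 𝓕⁻ (𝓕 φ) x := by rw [hinv]
    have i1 : Integrable fun ξ => Complex.exp (↑(2 * Real.pi * inner ℝ ξ x) * Complex.I) * 𝓕 φ ξ :=
      hFint.bdd_mul (c := 1) (by fun_prop : Continuous _).aestronglyMeasurable
        (ae_of_all _ fun ξ => (Complex.norm_exp_ofReal_mul_I _).le)
    have i2 : Integrable fun ξ => Complex.exp (↑(2 * Real.pi * inner ℝ ξ x) * Complex.I) *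
        (conj (charFun (μ (1 / ((k : ℝ≥0) + 1))) ((2 * Real.pi) • ξ)) * 𝓕 φ ξ) := by
      refine (hFint.bdd_mul (c := 1) ?_ (ae_of_all _ fun ξ => ?_)).bdd_mul (c := 1)
        (by fun_prop : Continuous _).aestronglyMeasurable
        (ae_of_all _ fun ξ => (Complex.norm_exp_ofReal_mul_I _).le)
      · exact (by fun_prop : Continuous fun ξ =>
          conj (charFun (μ (1 / ((k : ℝ≥0) + 1))) ((2 * Real.pi) • ξ))).aestronglyMeasurable
      · rw [RCLike.norm_conj]; exact norm_charFun_le_one _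
    rw [h1, h2, Real.fourierInv_eq', Real.fourierInv_eq']
    simp only [smul_eq_mul]
    rw [← integral_sub i2 i1, ← integral_const_mul]
    congr 1; ext ξ
    ring
  simp_rw [hk]
  rw [levyGenerator, Real.fourierInv_eq']
  simp only [smul_eq_mul]
  refine tendsto_integral_of_dominated_convergence
    (fun ξ => ‖-conj (ψ ((2 * Real.pi) • ξ)) * 𝓕 φ ξ‖) (fun k => ?_)
    (hμ.integrable_symbol_mul_fourier hψ hφ hsupp).norm (fun k => ae_of_all _ fun ξ => ?_)
    (ae_of_all _ fun ξ => ?_)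
  · have := hμ.prob (1 / ((k : ℝ≥0) + 1))
    exact (by fun_prop : Continuous _).aestronglyMeasurable
  · have h1 := hμ.norm_one_sub_charFun_le hψ (1 / ((k : ℝ≥0) + 1)) ((2 * Real.pi) • ξ)
    have h2 : ‖(k : ℂ) + 1‖ = (k : ℝ) + 1 := by
      rw [show (k : ℂ) + 1 = (((k : ℝ) + 1 : ℝ) : ℂ) by push_cast; rfl, Complex.norm_real,
        Real.norm_of_nonneg (by positivity)]
    have h3 : ‖conj (charFun (μ (1 / ((k : ℝ≥0) + 1))) ((2 * Real.pi) • ξ)) - 1‖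
        = ‖1 - charFun (μ (1 / ((k : ℝ≥0) + 1))) ((2 * Real.pi) • ξ)‖ := by
      rw [← norm_neg, ← RCLike.norm_conj]; simp
    rw [norm_mul, Complex.norm_exp_ofReal_mul_I, one_mul, norm_mul, norm_mul, norm_mul, norm_neg,
      RCLike.norm_conj, h2, h3]
    gcongr
    refine (mul_le_mul_of_nonneg_left h1 (by positivity)).trans (le_of_eq ?_)
    push_cast
    field_simp
  · have h1 := ((Complex.continuous_conj.tendsto _).comp
      (tendsto_exp_neg_sub_one_div (ψ ((2 * Real.pi) • ξ))))
    rw [map_neg] at h1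
    refine ((h1.mul_const (𝓕 φ ξ)).const_mul _).congr fun k => ?_
    rw [hψ]
    simp only [Function.comp_apply, map_mul, map_sub, map_add, map_one, map_natCast]
    push_cast
    rfl

/-- The generator maps test functions into `L¹`, by Fatou's lemma. -/
theorem IsLevySemigroup.integrable_generator (hμ : IsLevySemigroup μ)
    (hψ : IsCharacteristicExponent μ ψ) {φ : Rn n → ℂ} (hφ : ContDiff ℝ ∞ φ)
    (hsupp : HasCompactSupport φ) :
    Integrable (levyGenerator (fun ξ => conj (ψ ξ)) φ) := by
  obtain ⟨K, hKtop, hK⟩ := hμ.exists_lintegral_sub_le hψ hφ hsupp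
  obtain ⟨M, hM⟩ := hsupp.exists_bound_of_continuous hφ.continuous
  have hcont := hφ.continuous
  let D : ℕ → Rn n → ℂ := fun k x =>
    ((k : ℂ) + 1) * (∫ y, φ (x - y) ∂(μ (1 / ((k : ℝ≥0) + 1))) - φ x)
  have hDm : ∀ k, Continuous (D k) := fun k => by
    have := hμ.prob (1 / ((k : ℝ≥0) + 1))
    have h1 : Continuous fun x => ∫ y, φ (x - y) ∂(μ (1 / ((k : ℝ≥0) + 1))) :=
      continuous_of_dominated (bound := fun _ => M)
        (fun x => (by fun_prop : Continuous fun y => φ (x - y)).aestronglyMeasurable)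
        (fun x => ae_of_all _ fun y => hM _) (integrable_const _)
        (ae_of_all _ fun y => by fun_prop)
    fun_prop
  have hlim := hμ.tendsto_generator hψ hφ hsupp
  refine ⟨aestronglyMeasurable_of_tendsto_ae atTop (fun k => (hDm k).aestronglyMeasurable)
    (ae_of_all _ hlim), ?_⟩
  have hle : ∀ k, ∫⁻ x, ‖D k x‖ₑ ≤ K := fun k => by
    simp only [D, enorm_mul]
    rw [lintegral_const_mul' _ _ (by finiteness)]
    refine (mul_le_mul_right (hK _) _).trans ?_
    have h2 : ‖(k : ℂ) + 1‖ₑ = ((k : ℝ≥0) + 1 : ℝ≥0) := by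
      rw [show (k : ℂ) + 1 = (((k : ℝ) + 1 : ℝ) : ℂ) by push_cast; rfl, ← ofReal_norm,
        Complex.norm_real, Real.norm_of_nonneg (by positivity)]
      rw [ENNReal.ofReal, Real.toNNReal_add (by positivity) zero_le_one]
      simp
    rw [h2, mul_left_comm, ← ENNReal.coe_mul]
    simp
  rw [hasFiniteIntegral_iff_enorm]
  calc ∫⁻ x, ‖levyGenerator (fun ξ => conj (ψ ξ)) φ x‖ₑ
      = ∫⁻ x, liminf (fun k => ‖D k x‖ₑ) atTop :=
        lintegral_congr fun x => ((hlim x).enorm.liminf_eq).symm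
    _ ≤ liminf (fun k => ∫⁻ x, ‖D k x‖ₑ) atTop :=
        lintegral_liminf_le fun k => (hDm k).enorm.measurable
    _ ≤ K := liminf_le_of_le (by isBoundedDefault) fun b hb => by
        obtain ⟨k, hk⟩ := hb.exists
        exact hk.trans (hle k)
    _ < ⊤ := hKtop.lt_top

end Generator

/-! ### The Liouville properties and the zeros of the exponent -/

section Liouville

variable {n : ℕ} {μ : ℝ≥0 → Measure (Rn n)} {ψ : Rn n → ℂ}

theorem integral_mul_integral_sub (ρ : Measure (Rn n)) [IsProbabilityMeasure ρ] {f h : Rn n → ℂ}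
    (hf : MemLp f ∞ volume) (hh : Integrable h) :
    ∫ x, f x * ∫ y, h (x - y) ∂ρ = ∫ y, translatePairing f h y ∂ρ := by
  simp only [translatePairing, ← integral_const_mul]
  rw [integral_integral_swap]
  exact (integrable_mul_translate ρ hf hh).swap

theorem ae_integrable_translate (ρ : Measure (Rn n)) [IsProbabilityMeasure ρ] {f : Rn n → ℂ}
    (hf : MemLp f ∞ volume) : ∀ᵐ x, Integrable (fun y => f (x + y)) ρ := by
  obtain ⟨C, -, hC⟩ := hf.exists_ae_norm_le
  have hq : MeasurePreserving (fun p : Rn n × Rn n => (p.2, p.1 + p.2)) (volume.prod ρ)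
      (ρ.prod volume) := (measurePreserving_shear_add ρ).comp Measure.measurePreserving_swap
  have h1 : AEStronglyMeasurable (fun p : Rn n × Rn n => f (p.1 + p.2)) (volume.prod ρ) :=
    (hf.1.comp_snd (μ := ρ)).comp_measurePreserving hq
  have h2 : ∀ᵐ p ∂((volume : Measure (Rn n)).prod ρ), ‖f (p.1 + p.2)‖ ≤ C :=
    hq.quasiMeasurePreserving.ae (Measure.quasiMeasurePreserving_snd.ae hC)
  filter_upwards [h1.prodMk_left, Measure.ae_ae_of_ae_prod h2] with x hx1 hx2
  exact .of_bound hx1 C hx2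

theorem fourier_comp_sub_right (φ : Rn n → ℂ) (y ξ : Rn n) :
    𝓕 (fun x => φ (x - y)) ξ
      = Complex.exp (↑(-2 * Real.pi * inner ℝ y ξ) * Complex.I) * 𝓕 φ ξ := by
  rw [Real.fourier_eq', Real.fourier_eq', ← integral_const_mul, ← integral_add_right_eq_self _ y]
  congr 1; ext x
  rw [add_sub_cancel_right, smul_eq_mul, smul_eq_mul, ← mul_assoc, ← Complex.exp_add,
    inner_add_left]
  congr 2
  push_cast; ring

theorem levyGenerator_comp_sub_right (ψ φ : Rn n → ℂ) (y x : Rn n) :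
    levyGenerator ψ (fun x => φ (x - y)) x = levyGenerator ψ φ (x - y) := by
  rw [levyGenerator, levyGenerator, Real.fourierInv_eq', Real.fourierInv_eq']
  congr 1; ext ξ
  simp only [fourier_comp_sub_right, smul_eq_mul]
  have h : Complex.exp (↑(2 * Real.pi * inner ℝ ξ (x - y)) * Complex.I)
      = Complex.exp (↑(2 * Real.pi * inner ℝ ξ x) * Complex.I)
        * Complex.exp (↑(-2 * Real.pi * inner ℝ y ξ) * Complex.I) := by
    rw [← Complex.exp_add, inner_sub_right, real_inner_comm y ξ]
    congr 1
    push_cast; ring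
  rw [h]
  ring

theorem IsLevySemigroup.fourier_generator (hμ : IsLevySemigroup μ)
    (hψ : IsCharacteristicExponent μ ψ) {φ : Rn n → ℂ} (hφ : ContDiff ℝ ∞ φ)
    (hsupp : HasCompactSupport φ) (ξ : Rn n) :
    𝓕 (levyGenerator (fun ξ => conj (ψ ξ)) φ) ξ = -conj (ψ ((2 * Real.pi) • ξ)) * 𝓕 φ ξ := by
  have hψc := hμ.continuous_exponent hψ
  have hFc := continuous_fourier_of_hasCompactSupport hφ hsupp
  have h1 : Integrable (𝓕 fun ξ : Rn n => -conj (ψ ((2 * Real.pi) • ξ)) * 𝓕 φ ξ) := by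
    have := (hμ.integrable_generator hψ hφ hsupp).comp_neg
    refine this.congr (ae_of_all _ fun x => ?_)
    simp only [levyGenerator]
    rw [Real.fourierInv_eq_fourier_neg, neg_neg]
  have h2 := Continuous.fourier_fourierInv_eq (by fun_prop)
    (hμ.integrable_symbol_mul_fourier hψ hφ hsupp) h1
  exact congrFun h2 ξ

/-- The resolvent identity `φ - R₁^* φ = -R₁^* L^* φ` for test functions. -/
theorem IsLevySemigroup.sub_integral_resolventMeasure (hμ : IsLevySemigroup μ)
    (hψ : IsCharacteristicExponent μ ψ) {φ : Rn n → ℂ} (hφ : ContDiff ℝ ∞ φ)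
    (hsupp : HasCompactSupport φ) (x : Rn n) :
    φ x = ∫ y, φ (x - y) ∂(resolventMeasure μ 1)
      - ∫ y, levyGenerator (fun ξ => conj (ψ ξ)) φ (x - y) ∂(resolventMeasure μ 1) := by
  have := hμ.isProbabilityMeasure_resolventMeasure hψ one_pos
  have hinv := fourierInv_fourier_of_hasCompactSupport hφ hsupp
  have hFint := integrable_fourier_of_hasCompactSupport hφ hsupp
  have hGint := hμ.integrable_symbol_mul_fourier hψ hφ hsupp
  have h1 := integral_fourierInv_sub (resolventMeasure μ 1) hFint x
  have h2 := integral_fourierInv_sub (resolventMeasure μ 1) hGint x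
  have hb : ∀ h : Rn n → ℂ, Integrable h → Integrable fun ξ : Rn n =>
      Complex.exp (↑(2 * Real.pi * inner ℝ ξ x) * Complex.I) *
        (conj (charFun (resolventMeasure μ 1) ((2 * Real.pi) • ξ)) * h ξ) := fun h hh => by
    refine (hh.bdd_mul (c := 1) ?_ (ae_of_all _ fun ξ => ?_)).bdd_mul (c := 1)
      (by fun_prop : Continuous _).aestronglyMeasurable
      (ae_of_all _ fun ξ => (Complex.norm_exp_ofReal_mul_I _).le)
    · exact (by fun_prop : Continuous fun ξ =>
        conj (charFun (resolventMeasure μ 1) ((2 * Real.pi) • ξ))).aestronglyMeasurable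
    · rw [RCLike.norm_conj]; exact norm_charFun_le_one _
  have h3 : φ x = 𝓕⁻ (𝓕 φ) x := by rw [hinv]
  rw [hinv] at h1
  rw [h1]
  simp only [levyGenerator]
  rw [h2, h3, Real.fourierInv_eq', Real.fourierInv_eq', Real.fourierInv_eq']
  simp only [smul_eq_mul]
  rw [← integral_sub (hb _ hFint) (hb _ hGint)]
  congr 1; ext ξ
  rw [hμ.charFun_resolventMeasure hψ one_pos]
  have h0 := hμ.add_exponent_ne_zero hψ one_pos ((2 * Real.pi) • ξ)
  have h0' : (1 : ℂ) + conj (ψ ((2 * Real.pi) • ξ)) ≠ 0 := by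
    refine fun h => h0 ?_
    simpa using congrArg conj h
  simp only [map_div₀, map_add, Complex.ofReal_one, map_one]
  field_simp
  ring

theorem IsLevySemigroup.liouvilleProperty_of_forall (hμ : IsLevySemigroup μ)
    (hψ : IsCharacteristicExponent μ ψ) (hZ : ∀ ξ, ψ ξ = 0 → ξ = 0) : LiouvilleProperty ψ := by
  intro f hf hpair
  have := hμ.isProbabilityMeasure_resolventMeasure hψ one_pos
  refine isAEConst_of_integral_translatePairing_eq (resolventMeasure μ 1)
    (fun ξ hξ => hZ ξ ((hμ.charFun_resolventMeasure_eq_one_iff hψ one_pos ξ).1 hξ)) hf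
    fun φ hφ hsupp => ?_
  have hφint : Integrable φ := hφ.continuous.integrable_of_hasCompactSupport hsupp
  have hGint := hμ.integrable_generator hψ hφ hsupp
  -- `L_ψ^*` commutes with translations
  have h0 : ∀ y, translatePairing f (levyGenerator (fun ξ => conj (ψ ξ)) φ) y = 0 := fun y => by
    have := hpair (fun x => φ (x - y)) (by fun_prop) (hsupp.comp_homeomorph (Homeomorph.subRight y))
    simpa only [generatorPairing, levyGenerator_comp_sub_right, translatePairing] using this
  have h1 := integral_mul_integral_sub (resolventMeasure μ 1) hf hφint
  have h2 := integral_mul_integral_sub (resolventMeasure μ 1) hf hGint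
  simp only [h0, integral_zero] at h2
  have i1 : Integrable fun x => f x * ∫ y, φ (x - y) ∂(resolventMeasure μ 1) := by
    have := (integrable_mul_translate (resolventMeasure μ 1) hf hφint).swap.integral_prod_left
    simpa [integral_const_mul] using this
  have i2 : Integrable fun x => f x * ∫ y, levyGenerator (fun ξ => conj (ψ ξ)) φ (x - y)
      ∂(resolventMeasure μ 1) := by
    have := (integrable_mul_translate (resolventMeasure μ 1) hf hGint).swap.integral_prod_left
    simpa [integral_const_mul] using this
  calc ∫ y, translatePairing f φ y ∂(resolventMeasure μ 1)
      = ∫ x, (f x * ∫ y, φ (x - y) ∂(resolventMeasure μ 1)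
          - f x * ∫ y, levyGenerator (fun ξ => conj (ψ ξ)) φ (x - y) ∂(resolventMeasure μ 1)) := by
        rw [integral_sub i1 i2, h1, h2, sub_zero]
    _ = translatePairing f φ 0 := by
        simp only [translatePairing, sub_zero, ← mul_sub]
        congr 1; ext x
        rw [← hμ.sub_integral_resolventMeasure hψ hφ hsupp x]

/-- The complex exponentials at the zeros of `ψ` are in the kernel of `L_ψ`. -/
theorem IsLevySemigroup.generatorPairing_character (hμ : IsLevySemigroup μ)
    (hψ : IsCharacteristicExponent μ ψ) {η : Rn n} (hη : ψ η = 0) {φ : Rn n → ℂ}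
    (hφ : ContDiff ℝ ∞ φ) (hsupp : HasCompactSupport φ) :
    generatorPairing ψ (fun x => Complex.exp (((inner ℝ x η : ℝ) : ℂ) * Complex.I)) φ = 0 := by
  have := hμ.isProbabilityMeasure_resolventMeasure hψ one_pos
  -- the zeros of `ψ` are symmetric, being those of `charFun ρ - 1` for a probability measure `ρ`
  have hneg : ψ (-η) = 0 := by
    rw [← hμ.charFun_resolventMeasure_eq_one_iff hψ one_pos] at hη ⊢
    rw [charFun_neg, hη, map_one]
  have h1 := hμ.fourier_generator hψ hφ hsupp (-((2 * Real.pi)⁻¹ • η))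
  have hpi : (2 * Real.pi) ≠ 0 := by positivity
  rw [smul_neg, smul_smul, mul_inv_cancel₀ hpi, one_smul, hneg, map_zero, neg_zero, zero_mul,
    Real.fourier_eq'] at h1
  rw [generatorPairing, ← h1]
  congr 1; ext x
  rw [smul_eq_mul]
  congr 3
  rw [inner_neg_right, inner_smul_right]
  field_simp

theorem IsLevySemigroup.liouvilleProperty_iff (hμ : IsLevySemigroup μ)
    (hψ : IsCharacteristicExponent μ ψ) : LiouvilleProperty ψ ↔ ∀ ξ, ψ ξ = 0 → ξ = 0 := by
  refine ⟨fun h η hη => ?_, hμ.liouvilleProperty_of_forall hψ⟩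
  by_contra hne
  exact not_isAEConst_character hne (h _ (memLp_character η) fun φ hφ hsupp =>
    hμ.generatorPairing_character hψ hη hφ hsupp)

theorem IsLevySemigroup.resolventOp_ae_eq (hμ : IsLevySemigroup μ)
    (hψ : IsCharacteristicExponent μ ψ) {τ : ℝ} (hτ : 0 < τ) {f : Rn n → ℂ}
    (hf : MemLp f ∞ volume) :
    (fun x => (τ : ℂ) * resolventOp μ τ f x)
      =ᵐ[volume] fun x => ∫ y, f (x + y) ∂(resolventMeasure μ τ) := by
  have := hμ.isProbabilityMeasure_resolventMeasure hψ hτ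
  filter_upwards [ae_integrable_translate (resolventMeasure μ τ) hf] with x hx
  rw [resolventMeasure, integral_bind_eq (κ := fun t : ℝ => μ t.toNNReal)
    ((hμ.measurable hψ).comp measurable_real_toNNReal) hx, integral_expLaw hτ]
  rfl

/-- For a probability measure `ρ`, all `f ∈ L^∞` which coincide with their `ρ`-averages are
constant if and only if the characteristic function of `ρ` takes the value `1` only at `0`. -/
theorem forall_isAEConst_iff (ρ : Measure (Rn n)) [IsProbabilityMeasure ρ] :
    (∀ f : Rn n → ℂ, MemLp f ∞ volume → (fun x => ∫ y, f (x + y) ∂ρ) =ᵐ[volume] f → IsAEConst f) ↔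
      ∀ ξ, charFun ρ ξ = 1 → ξ = 0 := by
  refine ⟨fun h η hη => ?_, fun hρ f hf hfρ =>
    isAEConst_of_integral_translatePairing_eq ρ hρ hf fun φ hφ hsupp =>
      integral_translatePairing_eq_of_ae_eq ρ hf hfρ
        (hφ.continuous.integrable_of_hasCompactSupport hsupp)⟩
  by_contra hne
  refine not_isAEConst_character hne (h _ (memLp_character η) (ae_of_all _ fun x => ?_))
  simp only [integral_character_add, hη, one_mul]

theorem IsLevySemigroup.resolventLiouville_iff (hμ : IsLevySemigroup μ)
    (hψ : IsCharacteristicExponent μ ψ) {τ : ℝ} (hτ : 0 < τ) :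
    ResolventLiouville μ τ ↔ ∀ ξ, ψ ξ = 0 → ξ = 0 := by
  have := hμ.isProbabilityMeasure_resolventMeasure hψ hτ
  simp only [← hμ.charFun_resolventMeasure_eq_one_iff hψ hτ]
  rw [← forall_isAEConst_iff]
  refine forall₂_congr fun f hf => ?_
  have h1 := hμ.resolventOp_ae_eq hψ hτ hf
  exact ⟨fun h h2 => h (h1.trans h2), fun h h2 => h (h1.symm.trans h2)⟩

theorem IsLevySemigroup.semigroupLiouville_iff (hμ : IsLevySemigroup μ)
    (hψ : IsCharacteristicExponent μ ψ) (hreal : ∀ ξ, conj (ψ ξ) = ψ ξ) {t : ℝ≥0} (ht : 0 < t) :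
    SemigroupLiouville μ t ↔ ∀ ξ, ψ ξ = 0 → ξ = 0 := by
  have := hμ.prob t
  refine (forall_isAEConst_iff (μ t)).trans (forall_congr' fun ξ => ?_)
  have h1 : charFun (μ t) ξ = 1 ↔ ψ ξ = 0 := by
    obtain ⟨r, hr⟩ := Complex.conj_eq_iff_real.1 (hreal ξ)
    rw [hψ, hr, ← Complex.ofReal_neg, ← Complex.ofReal_mul, ← Complex.ofReal_exp,
      Complex.ofReal_eq_one, Real.exp_eq_one_iff, Complex.ofReal_eq_zero]
    simp [ht.ne']
  rw [h1]

end Liouville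

/-! ### Subordination -/

section Subordination

variable {n : ℕ} {μ : ℝ≥0 → Measure (Rn n)} {ψ : Rn n → ℂ} {a : ℝ} {π : Measure ℝ}

/-- The characteristic functions of probability measures on `ℝⁿ`. -/
def IsCharFun (f : Rn n → ℂ) : Prop :=
  ∃ ρ : Measure (Rn n), IsProbabilityMeasure ρ ∧ charFun ρ = f

theorem IsCharFun.mul {f g : Rn n → ℂ} (hf : IsCharFun f) (hg : IsCharFun g) :
    IsCharFun fun ξ => f ξ * g ξ := by
  obtain ⟨ρ, hρ, rfl⟩ := hf
  obtain ⟨σ, hσ, rfl⟩ := hg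
  exact ⟨ρ.conv σ, inferInstance, funext fun ξ => charFun_conv ξ⟩

theorem isCharFun_one : IsCharFun fun _ : Rn n => (1 : ℂ) :=
  ⟨Measure.dirac 0, inferInstance, by ext ξ; simp [charFun_dirac]⟩

theorem IsCharFun.pow {f : Rn n → ℂ} (hf : IsCharFun f) (k : ℕ) : IsCharFun fun ξ => f ξ ^ k := by
  induction k with
  | zero => simpa using isCharFun_one
  | succ k ih => simpa only [pow_succ] using ih.mul hf

/-- The compound Poisson law with rate `r`: a Poisson mixture of the convolution powers. -/
theorem IsCharFun.exp_sub_one {f : Rn n → ℂ} (hf : IsCharFun f) (r : ℝ≥0) :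
    IsCharFun fun ξ => Complex.exp (r * (f ξ - 1)) := by
  choose κ hκp hκ using hf.pow
  refine ⟨(poissonMeasure r).bind κ,
    isProbabilityMeasure_bind Measurable.of_discrete.aemeasurable (ae_of_all _ hκp), ?_⟩
  ext ξ
  rw [charFun_bind Measurable.of_discrete hκp, integral_poissonMeasure]
  simp only [hκ, Complex.real_smul]
  have h1 := NormedSpace.expSeries_div_hasSum_exp (𝔸 := ℂ) ((r : ℂ) * f ξ)
  rw [mul_sub, mul_one, sub_eq_neg_add, Complex.exp_add, Complex.exp_eq_exp_ℂ, ← h1.tsum_eq,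
    ← tsum_mul_left]
  refine tsum_congr fun k => ?_
  rw [← Complex.exp_eq_exp_ℂ, mul_pow]
  push_cast
  ring

theorem IsBernsteinPair.integrable_min_one (h : IsBernsteinPair a π) :
    IntegrableOn (fun s => min s 1) (Ioi 0) π := by
  refine ⟨(by fun_prop : Continuous fun s : ℝ => min s 1).aestronglyMeasurable, ?_⟩
  rw [hasFiniteIntegral_iff_ofReal]
  · exact h.integrable_min
  · exact (ae_restrict_iff' measurableSet_Ioi).2 (ae_of_all _ fun s hs => le_min (le_of_lt hs)
      zero_le_one)

theorem norm_one_sub_exp_le_min {ζ : ℂ} (hζ : 0 ≤ ζ.re) {s : ℝ} (hs : 0 < s) :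
    ‖1 - Complex.exp (-ζ * s)‖ ≤ (2 + ‖ζ‖) * min s 1 := by
  have hre : 0 ≤ (ζ * s).re := by simpa using mul_nonneg hζ hs.le
  rcases le_total s 1 with h | h
  · rw [min_eq_left h, neg_mul]
    refine (norm_one_sub_exp_neg_le hre).trans ?_
    rw [norm_mul, Complex.norm_real, Real.norm_of_nonneg hs.le]
    nlinarith
  · rw [min_eq_right h, mul_one]
    refine (norm_sub_le _ _).trans ?_
    rw [norm_one, Complex.norm_exp, neg_mul, Complex.neg_re]
    have := Real.exp_le_one_iff.2 (neg_nonpos.2 hre)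
    linarith [norm_nonneg ζ]

theorem IsBernsteinPair.integrableOn_one_sub_exp (h : IsBernsteinPair a π) {ζ : ℂ}
    (hζ : 0 ≤ ζ.re) : IntegrableOn (fun s : ℝ => 1 - Complex.exp (-ζ * s)) (Ioi 0) π :=
  (h.integrable_min_one.const_mul (2 + ‖ζ‖)).mono'
    (by fun_prop : Continuous fun s : ℝ => 1 - Complex.exp (-ζ * s)).aestronglyMeasurable
    ((ae_restrict_iff' measurableSet_Ioi).2 (ae_of_all _ fun _ hs => norm_one_sub_exp_le_min hζ hs))

theorem IsBernsteinPair.measure_Ioi_lt_top (h : IsBernsteinPair a π) {ε : ℝ} (hε : 0 < ε) :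
    π (Ioi ε) < ⊤ := by
  have h1 : ENNReal.ofReal (min ε 1) * π (Ioi ε) ≤
      ∫⁻ s in Ioi (0 : ℝ), ENNReal.ofReal (min s 1) ∂π := by
    rw [← setLIntegral_const]
    refine (setLIntegral_mono' measurableSet_Ioi fun s hs => ?_).trans
      (lintegral_mono_set (Ioi_subset_Ioi hε.le))
    exact ENNReal.ofReal_le_ofReal (min_le_min_right 1 (le_of_lt hs))
  refine lt_of_le_of_ne le_top fun htop => ?_
  rw [htop, ENNReal.mul_top (by simpa using hε)] at h1
  exact (lt_of_le_of_lt h1 h.integrable_min).ne rfl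

/-- Subordination by the compound Poisson subordinator with jump measure `π` restricted to the
jumps larger than `ε`. -/
theorem IsLevySemigroup.isCharFun_exp_setIntegral (hμ : IsLevySemigroup μ)
    (hψ : IsCharacteristicExponent μ ψ) (h : IsBernsteinPair a π) {ε : ℝ} (hε : 0 < ε) (t : ℝ≥0) :
    IsCharFun fun ξ => Complex.exp (-(t : ℝ) * ∫ s in Ioi ε, (1 - Complex.exp (-ψ ξ * s)) ∂π) := by
  have hfin := h.measure_Ioi_lt_top hε
  by_cases h0 : π (Ioi ε) = 0
  · simp only [Measure.restrict_eq_zero.2 h0, integral_zero_measure, mul_zero, Complex.exp_zero]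
    exact isCharFun_one
  let p : Measure ℝ := (π (Ioi ε))⁻¹ • π.restrict (Ioi ε)
  have hp : IsProbabilityMeasure p := ⟨by
    simp only [p, Measure.smul_apply, Measure.restrict_apply_univ, smul_eq_mul]
    exact ENNReal.inv_mul_cancel h0 hfin.ne⟩
  have hmeas : Measurable fun s : ℝ => μ s.toNNReal :=
    (hμ.measurable hψ).comp measurable_real_toNNReal
  have hcf : IsCharFun (charFun (p.bind fun s => μ s.toNNReal)) :=
    ⟨_, isProbabilityMeasure_bind hmeas.aemeasurable (ae_of_all _ fun s => hμ.prob _), rfl⟩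
  convert hcf.exp_sub_one (t * (π (Ioi ε)).toNNReal) using 2 with ξ
  congr 1
  have i1 : IntegrableOn (fun s : ℝ => 1 - Complex.exp (-ψ ξ * s)) (Ioi ε) π :=
    (h.integrableOn_one_sub_exp (hμ.re_exponent_nonneg hψ ξ)).mono_set (Ioi_subset_Ioi hε.le)
  have i2 : IntegrableOn (fun _ : ℝ => (1 : ℂ)) (Ioi ε) π := integrableOn_const hfin.ne
  have h1 : charFun (p.bind fun s => μ s.toNNReal) ξ
      = ((π (Ioi ε)).toReal⁻¹ : ℝ) * ∫ s in Ioi ε, Complex.exp (-ψ ξ * s) ∂π := by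
    rw [charFun_bind hmeas (fun s => hμ.prob _), integral_smul_measure, ENNReal.toReal_inv,
      Complex.real_smul]
    congr 1
    refine setIntegral_congr_fun measurableSet_Ioi fun s hs => ?_
    simp only [hψ.charFun_toNNReal (hε.le.trans (le_of_lt hs))]
    congr 1; ring
  have i3 : IntegrableOn (fun s : ℝ => Complex.exp (-ψ ξ * s)) (Ioi ε) π := by
    refine (i2.sub i1).congr (ae_of_all _ fun s => ?_)
    simp
  have hne : ((π (Ioi ε)).toReal : ℂ) ≠ 0 :=
    Complex.ofReal_ne_zero.2 (ENNReal.toReal_ne_zero.2 ⟨h0, hfin.ne⟩)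
  rw [h1, integral_sub i2 i3, setIntegral_const, measureReal_def, Complex.real_smul, mul_one]
  push_cast
  field_simp
  ring

theorem IsLevySemigroup.isCharFun_exp_bernsteinFun (hμ : IsLevySemigroup μ)
    (hψ : IsCharacteristicExponent μ ψ) (h : IsBernsteinPair a π) (t : ℝ≥0) :
    IsCharFun fun ξ => Complex.exp (-(t : ℝ) * bernsteinFun a π (ψ ξ)) := by
  let ε : ℕ → ℝ := fun k => 1 / ((k : ℝ) + 1)
  have hε : ∀ k, 0 < ε k := fun k => by positivity
  have hre := hμ.re_exponent_nonneg hψ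
  have hdrift : IsCharFun fun ξ => Complex.exp (-(t : ℝ) * (a * ψ ξ)) := by
    refine ⟨μ (t * a.toNNReal), hμ.prob _, ?_⟩
    ext ξ
    rw [hψ, NNReal.coe_mul, Real.coe_toNNReal a h.drift_nonneg, Complex.ofReal_mul]
    congr 1
    ring
  -- the small jumps are restored in the limit `ε k → 0`
  choose ν hνp hν using fun k =>
    hdrift.mul (hμ.isCharFun_exp_setIntegral hψ h (hε k) t)
  refine exists_charFun_eq_of_tendsto hνp ?_ fun ξ => ?_
  · have hc := hμ.continuous_exponent hψ
    have hint : ContinuousAt (fun ξ => ∫ s in Ioi (0 : ℝ), (1 - Complex.exp (-ψ ξ * s)) ∂π) 0 := by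
      refine continuousAt_of_dominated (bound := fun s => (2 + 1) * min s 1)
        (Eventually.of_forall fun ξ => (by fun_prop : Continuous fun s : ℝ =>
          1 - Complex.exp (-ψ ξ * s)).aestronglyMeasurable) ?_
        (h.integrable_min_one.const_mul _) (ae_of_all _ fun s => by fun_prop)
      have h1 : ∀ᶠ ξ in 𝓝 (0 : Rn n), ‖ψ ξ‖ < 1 := by
        refine hc.norm.continuousAt.eventually_lt continuousAt_const ?_
        simp [hμ.exponent_zero hψ]
      filter_upwards [h1] with ξ hξ
      refine (ae_restrict_iff' measurableSet_Ioi).2 (ae_of_all _ fun s hs => ?_)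
      refine (norm_one_sub_exp_le_min (hre ξ) hs).trans ?_
      have : 0 ≤ min s 1 := le_min (le_of_lt hs) zero_le_one
      gcongr
    have hψ0 := hc.continuousAt (x := (0 : Rn n))
    unfold bernsteinFun
    fun_prop
  · have hU : ⋃ k, Ioi (ε k) = Ioi (0 : ℝ) := by
      ext s
      simp only [mem_iUnion, mem_Ioi]
      exact ⟨fun ⟨k, hk⟩ => (hε k).trans hk, fun hs => exists_nat_one_div_lt hs⟩
    have hlim := tendsto_setIntegral_of_monotone (μ := π) (s := fun k => Ioi (ε k))
      (f := fun s : ℝ => 1 - Complex.exp (-ψ ξ * s)) (fun k => measurableSet_Ioi)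
      (fun k l hkl => Ioi_subset_Ioi (one_div_le_one_div_of_le (by positivity) (by gcongr)))
      (by rw [hU]; exact h.integrableOn_one_sub_exp (hre ξ))
    rw [hU] at hlim
    have h2 := (Complex.continuous_exp.tendsto _).comp (hlim.const_mul (-((t : ℝ) : ℂ)))
    have h3 := h2.const_mul (Complex.exp (-(t : ℝ) * (a * ψ ξ)))
    rw [← Complex.exp_add, ← mul_add] at h3
    refine h3.congr fun k => ?_
    rw [hν]
    rfl

/-- Bochner's subordination: a Bernstein function of a characteristic exponent is the exponent of
a Lévy process. -/
theorem IsLevySemigroup.exists_subordinate (hμ : IsLevySemigroup μ)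
    (hψ : IsCharacteristicExponent μ ψ) (h : IsBernsteinPair a π) :
    ∃ ρ : ℝ≥0 → Measure (Rn n), IsLevySemigroup ρ ∧
      IsCharacteristicExponent ρ fun ξ => bernsteinFun a π (ψ ξ) := by
  choose ρ hρp hρ using hμ.isCharFun_exp_bernsteinFun hψ h
  have hρ' : IsCharacteristicExponent ρ fun ξ => bernsteinFun a π (ψ ξ) := fun t ξ => by rw [hρ]
  refine ⟨ρ, ⟨hρp, ?_, fun s t => ?_, fun u => ?_⟩, hρ'⟩
  · refine Measure.ext_of_charFun ?_
    ext ξ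
    simp [hρ, charFun_dirac]
  · refine Measure.ext_of_charFun ?_
    ext ξ
    rw [charFun_conv, hρ' _ ξ, hρ' _ ξ, hρ' _ ξ, ← Complex.exp_add]
    congr 1
    push_cast; ring
  · let κ : ℝ≥0 → ProbabilityMeasure (Rn n) := fun t => ⟨ρ t, hρp t⟩
    have hκ : Continuous κ := continuous_probabilityMeasure_of_charFun fun ξ => by
      simp only [κ, ProbabilityMeasure.coe_mk, hρ' _ ξ]
      fun_prop
    have h1 := ProbabilityMeasure.tendsto_iff_forall_integral_tendsto.1 (hκ.tendsto 0) u
    have h2 : ρ 0 = Measure.dirac 0 := by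
      refine Measure.ext_of_charFun ?_
      ext ξ
      simp [hρ, charFun_dirac]
    simpa [κ, h2] using h1

/-- Distinct solutions of `exp (-ζ s) = 1` have distance at least `2 π / ‖ζ‖`. -/
theorem isDiscrete_setOf_exp_eq_one {ζ : ℂ} (hζ : ζ ≠ 0) :
    IsDiscrete {s : ℝ | Complex.exp (-ζ * s) = 1} := by
  have hpos : 0 < 2 * Real.pi / ‖ζ‖ := div_pos Real.two_pi_pos (norm_pos_iff.2 hζ)
  refine ⟨DiscreteTopology.of_forall_le_dist hpos fun x y hxy => ?_⟩
  obtain ⟨k, hk⟩ := Complex.exp_eq_one_iff.1 x.2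
  obtain ⟨l, hl⟩ := Complex.exp_eq_one_iff.1 y.2
  have h1 : ζ * ((y : ℝ) - (x : ℝ) : ℝ) = ((k - l : ℤ) : ℂ) * (2 * Real.pi * Complex.I) := by
    push_cast
    linear_combination hk - hl
  have hkl : k - l ≠ 0 := by
    intro h0
    rw [h0] at h1
    simp only [Int.cast_zero, zero_mul, mul_eq_zero, hζ, false_or, Complex.ofReal_eq_zero] at h1
    exact hxy (Subtype.ext (sub_eq_zero.1 h1).symm)
  have h2 := congrArg norm h1
  rw [norm_mul, norm_mul, Complex.norm_real] at h2
  have h3 : (1 : ℝ) ≤ ‖((k - l : ℤ) : ℂ)‖ := by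
    rw [Complex.norm_intCast]
    exact_mod_cast Int.one_le_abs hkl
  have h4 : ‖(2 * Real.pi * Complex.I : ℂ)‖ = 2 * Real.pi := by
    simp [abs_of_pos Real.pi_pos]
  rw [h4] at h2
  rw [div_le_iff₀ (norm_pos_iff.2 hζ), dist_comm, Subtype.dist_eq, Real.dist_eq, ← Real.norm_eq_abs,
    mul_comm ‖_‖ ‖ζ‖, h2]
  nlinarith [Real.pi_pos]

/-- The only zero of a Bernstein function in the closed right half-plane is `0`, provided that it
has a drift or that the support of its Lévy measure is not discrete. -/
theorem IsBernsteinPair.eq_zero_of_bernsteinFun_eq_zero (h : IsBernsteinPair a π)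
    (hd : a ≠ 0 ∨ ¬ IsDiscrete π.support) {ζ : ℂ} (hζ : 0 ≤ ζ.re) (h0 : bernsteinFun a π ζ = 0) :
    ζ = 0 := by
  have hint := h.integrableOn_one_sub_exp hζ
  have hnorm : ∀ s : ℝ, s ∈ Ioi (0 : ℝ) → ‖Complex.exp (-ζ * s)‖ ≤ 1 := fun s hs => by
    rw [Complex.norm_exp, Real.exp_le_one_iff]
    simpa using mul_nonneg hζ (le_of_lt hs)
  have hnn : 0 ≤ᵐ[π.restrict (Ioi 0)] fun s : ℝ => (1 - Complex.exp (-ζ * s)).re := by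
    refine (ae_restrict_iff' measurableSet_Ioi).2 (ae_of_all _ fun s hs => ?_)
    have := (Complex.re_le_norm _).trans (hnorm s hs)
    simpa using this
  have hre : (∫ s in Ioi (0 : ℝ), (1 - Complex.exp (-ζ * s)) ∂π).re
      = ∫ s in Ioi (0 : ℝ), (1 - Complex.exp (-ζ * s)).re ∂π :=
    (integral_re hint).symm
  have h1 := congrArg Complex.re h0
  rw [bernsteinFun, Complex.add_re, hre, Complex.re_ofReal_mul, Complex.zero_re] at h1
  have h2 : 0 ≤ a * ζ.re := mul_nonneg h.drift_nonneg hζ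
  have h3 := integral_nonneg_of_ae hnn
  -- the real part of `g ζ` is a sum of two nonnegative terms, so both vanish
  have h4 : ∫ s in Ioi (0 : ℝ), (1 - Complex.exp (-ζ * s)).re ∂π = 0 := by linarith
  have h5 : ∀ᵐ s ∂(π.restrict (Ioi 0)), Complex.exp (-ζ * (s : ℝ)) = 1 := by
    filter_upwards [(integral_eq_zero_iff_of_nonneg_ae hnn hint.re).1 h4,
      ae_restrict_mem measurableSet_Ioi] with s hs hs0
    have hs1 : (Complex.exp (-ζ * s)).re = 1 := by
      have : 1 - (Complex.exp (-ζ * s)).re = 0 := hs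
      linarith
    have hs2 := hnorm s hs0
    have hs3 := Complex.sq_norm (Complex.exp (-ζ * s))
    rw [Complex.normSq_apply, hs1] at hs3
    refine Complex.ext hs1 ?_
    have : (Complex.exp (-ζ * s)).im ^ 2 ≤ 0 := by nlinarith [norm_nonneg (Complex.exp (-ζ * s))]
    simpa using le_antisymm this (sq_nonneg _)
  rcases hd with ha | hd
  · have h6 : ∫ s in Ioi (0 : ℝ), (1 - Complex.exp (-ζ * s)) ∂π = 0 := by
      refine integral_eq_zero_of_ae ?_
      filter_upwards [h5] with s hs
      simp only [hs, sub_self, Pi.zero_apply]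
    rw [bernsteinFun, h6, add_zero] at h0
    simpa [ha] using h0
  · by_contra hne
    refine hd ((isDiscrete_setOf_exp_eq_one hne).mono
      (Measure.support_subset_of_isClosed (isClosed_eq (by fun_prop) (by fun_prop)) ?_))
    have h6 : ∀ᵐ s ∂π, s ∈ Ioi (0 : ℝ) := by
      rw [ae_iff]
      simpa [← Iic_def] using h.concentrated
    filter_upwards [(ae_restrict_iff' measurableSet_Ioi).1 h5, h6] with s hs hs0 using hs hs0

theorem bernsteinFun_zero (a : ℝ) (π : Measure ℝ) : bernsteinFun a π 0 = 0 := by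
  simp [bernsteinFun]

end Subordination

theorem corollary1 (n : ℕ) (μ : ℝ≥0 → Measure (Rn n)) (ψ : Rn n → ℂ)
    (hμ : IsLevySemigroup μ) (hψ : IsCharacteristicExponent μ ψ) :
    (∀ (a : ℝ) (π : Measure ℝ), IsBernsteinPair a π → (a ≠ 0 ∨ ¬ IsDiscrete π.support) →
      (∃ ρ : ℝ≥0 → Measure (Rn n), IsLevySemigroup ρ ∧
        IsCharacteristicExponent ρ (fun ξ => bernsteinFun a π (ψ ξ))) ∧
      (LiouvilleProperty ψ ↔ LiouvilleProperty (fun ξ => bernsteinFun a π (ψ ξ)))) ∧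
    (LiouvilleProperty ψ ↔ ∃ τ : ℝ, 0 < τ ∧ ResolventLiouville μ τ) ∧
    (LiouvilleProperty ψ ↔ ∀ τ : ℝ, 0 < τ → ResolventLiouville μ τ) ∧
    ((∀ ξ, conj (ψ ξ) = ψ ξ) →
      (LiouvilleProperty ψ ↔ ∃ t : ℝ≥0, 0 < t ∧ SemigroupLiouville μ t) ∧
      (LiouvilleProperty ψ ↔ ∀ t : ℝ≥0, 0 < t → SemigroupLiouville μ t)) := by
  have hL := hμ.liouvilleProperty_iff hψ
  have hR : ∀ τ : ℝ, 0 < τ → (LiouvilleProperty ψ ↔ ResolventLiouville μ τ) := fun τ hτ =>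
    hL.trans (hμ.resolventLiouville_iff hψ hτ).symm
  refine ⟨fun a π hπ hd => ?_, ⟨fun h => ⟨1, one_pos, (hR 1 one_pos).1 h⟩,
    fun ⟨τ, hτ, h⟩ => (hR τ hτ).2 h⟩, ⟨fun h τ hτ => (hR τ hτ).1 h,
    fun h => (hR 1 one_pos).2 (h 1 one_pos)⟩, fun hreal => ?_⟩
  · obtain ⟨ρ, hρ, hρψ⟩ := hμ.exists_subordinate hψ hπ
    refine ⟨⟨ρ, hρ, hρψ⟩, ?_⟩
    rw [hL, hρ.liouvilleProperty_iff hρψ]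
    refine forall_congr' fun ξ => imp_congr_left ⟨fun h => ?_, fun h =>
      hπ.eq_zero_of_bernsteinFun_eq_zero hd (hμ.re_exponent_nonneg hψ ξ) h⟩
    rw [h, bernsteinFun_zero]
  · have hS : ∀ t : ℝ≥0, 0 < t → (LiouvilleProperty ψ ↔ SemigroupLiouville μ t) := fun t ht =>
      hL.trans (hμ.semigroupLiouville_iff hψ hreal ht).symm
    exact ⟨⟨fun h => ⟨1, one_pos, (hS 1 one_pos).1 h⟩, fun ⟨t, ht, h⟩ => (hS t ht).2 h⟩,
      fun h t ht => (hS t ht).1 h, fun h => (hS 1 one_pos).2 (h 1 one_pos)⟩
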